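/- For distributions $p,q$ on $[n]=\{1,\dots,n\}$ let $\mathcal U$ be the uniform distribution on $[n]$ and let $\Pi_q=\{(1-\alpha)q+\alpha\,\mathcal U : \alpha\in[0,1]\}$. A closeness tester in the presence of uniform noise, with proximity parameter $\epsilon$, is a randomized algorithm (which may depend on $n$ and $\epsilon$) that can, adaptively, request independent samples from each of the two unknown distributions $p$ and $q$, and that, for all distributions $p,q$ on $[n]$, - accepts with probability at least $2/3$ if $p\in\Pi_q$, and - rejects with probability at least $2/3$ if $\|p-r\|_1\ge\epsilon$ for every $r\in\Pi_q$. There is an absolute constant $c>0$ such that for every $n\ge 2$, every $0<\epsilon\le 1$ and every such tester that draws at most $s$ samples in total (from $p$ and $q$ together) in every execution, $$ s\;\ge\; c\cdot\max\left(\frac{n^{2/3}}{\epsilon^{4/3}},\;\frac{\sqrt n}{\epsilon^{2}}\right). $$ -/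

import Mathlib

namespace MixtureTesting

/-- The `ℓ₁`-distance between two distributions on `[n]`. -/
noncomputable def l1Dist {n : ℕ} (p q : PMF (Fin n)) : ℝ :=
  ∑ i, |(p i).toReal - (q i).toReal|

/-- The set of all mixtures `(1 - α) q₁ + α q₂` with `α ∈ [0, 1]`. -/
def mixtures {n : ℕ} (q₁ q₂ : PMF (Fin n)) : Set (PMF (Fin n)) :=
  {r | ∃ α ∈ Set.Icc (0 : ℝ) 1,
    ∀ i, (r i).toReal = (1 - α) * (q₁ i).toReal + α * (q₂ i).toReal}

/-- `p` is `ε`-far from the property `P`: its `ℓ₁`-distance to every member is at least `ε`. -/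
def IsFar {n : ℕ} (ε : ℝ) (p : PMF (Fin n)) (P : Set (PMF (Fin n))) : Prop :=
  ∀ r ∈ P, ε ≤ l1Dist p r

/-- A randomized algorithm with oracle access to samples from two unknown distributions `p`, `q`
on `[n]`. At each step it stops and outputs `true` (accept) or `false` (reject), uses internal
randomness, or requests a fresh sample from `p` or from `q`; the continuation may depend on
everything seen so far. -/
inductive Algorithm (n : ℕ) : Type
  | output (b : Bool) : Algorithm n
  | coin (μ : PMF ℕ) (next : ℕ → Algorithm n) : Algorithm n
  | sampleP (next : Fin n → Algorithm n) : Algorithm n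
  | sampleQ (next : Fin n → Algorithm n) : Algorithm n

/-- The distribution of the output, when the oracles return independent samples
from `p` and `q`. -/
noncomputable def Algorithm.run {n : ℕ} (p q : PMF (Fin n)) : Algorithm n → PMF Bool
  | .output b => PMF.pure b
  | .coin μ next => μ.bind fun j => (next j).run p q
  | .sampleP next => p.bind fun x => (next x).run p q
  | .sampleQ next => q.bind fun x => (next x).run p q

/-- In every execution the algorithm requests at most `s` samples, those from `p` and those
from `q` counted together. -/
def Algorithm.DrawsAtMost {n : ℕ} : Algorithm n → ℕ → Prop
  | .output _, _ => True
  | .coin _ next, s => ∀ j, (next j).DrawsAtMost s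
  | .sampleP _, 0 => False
  | .sampleP next, s + 1 => ∀ x, (next x).DrawsAtMost s
  | .sampleQ _, 0 => False
  | .sampleQ next, s + 1 => ∀ x, (next x).DrawsAtMost s

/-- A closeness tester in the presence of the known noise `η`, with proximity parameter `ε`. -/
def IsClosenessTester {n : ℕ} (η : PMF (Fin n)) (ε : ℝ) (T : Algorithm n) : Prop :=
  ∀ p q : PMF (Fin n),
    (p ∈ mixtures q η → 2 / 3 ≤ T.run p q true) ∧
    (IsFar ε p (mixtures q η) → 2 / 3 ≤ T.run p q false)

end MixtureTesting

/-!
A tester separates every prior on accepted instances from every prior on rejected ones, so the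
corresponding mixtures of product laws of `2s` samples are at `ℓ₁`-distance at least `1 / 3`.

For `√n / ε²`, let `q` be uniform on `⌊n / 2⌋` pairs and let `p` be either `q` or its tilt by `±ε`
on each pair with random signs: the `χ²`-divergence between the mixtures is `exp (O(s²ε⁴ / n)) - 1`.

For `n ^ (2 / 3) / ε ^ (4 / 3)`, use `2s` equally likely blocks of about `n / (8s)` pairs. In each
block most of the mass lies on a few heavy pairs at random positions, and mass of order `ε` is
spread over all pairs, each with a random orientation, which `p` and `q` either share or have
opposite. Only two light samples from the same pair carry information on the orientations, but their
collision looks like a repeated hit on a heavy pair that no other sample uses, and that is likelier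
by a factor of order `M / ε²`, where `M` is the number of pairs per block. Hence a block with at
least two samples changes its law by a relative `O(ε² / M)` only, at a cost exponential in its
number of samples, which is `O(1)` on average. Since `χ²`-divergences multiply over the blocks, the
squared distance is `O(s (ε² / M)²) = O(s³ε⁴ / n²)`.
-/

namespace MixtureTesting

open Finset
open scoped BigOperators

section Expectation

lemma expect_pi_prod {ι : Type*} {κ : ι → Type*} [Fintype ι] [DecidableEq ι] [∀ i, Fintype (κ i)]
    (g : ∀ i, κ i → ℝ) : 𝔼 x : ∀ i, κ i, ∏ i, g i (x i) = ∏ i, 𝔼 k, g i k := by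
  simp only [Fintype.expect_eq_sum_div_card, prod_div_distrib, Fintype.prod_sum, Fintype.card_pi,
    Nat.cast_prod]

lemma expect_prod_type {α β : Type*} [Fintype α] [Fintype β] (f : α × β → ℝ) :
    𝔼 x, f x = 𝔼 a, 𝔼 b, f (a, b) := by
  rw [← univ_product_univ, expect_product]

lemma sum_eq_card_pow_mul_expect {ι κ W : Type*} [Fintype ι] [DecidableEq ι] [Fintype κ] [Fintype W]
    (F : (ι → κ × W) → ℝ) :
    ∑ X, F X = Fintype.card κ ^ Fintype.card ι *
      𝔼 J : ι → κ, ∑ Y : ι → W, F fun i => (J i, Y i) := by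
  rw [← (Equiv.arrowProdEquivProdArrow ι (fun _ => κ) fun _ => W).symm.sum_comp,
    Fintype.sum_prod_type, ← Fintype.card_mul_expect, Fintype.card_fun, Nat.cast_pow]
  rfl

lemma sq_expect_le_expect_sq {ι : Type*} [Fintype ι] [Nonempty ι] (g : ι → ℝ) :
    (𝔼 i, g i) ^ 2 ≤ 𝔼 i, g i ^ 2 := by
  simpa only [mul_one, one_pow, Fintype.expect_const] using
    expect_mul_sq_le_sq_mul_sq univ g fun _ => 1

end Expectation

section ChiSquare

variable {Ω : Type*} [Fintype Ω] {P Q : Ω → ℝ}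

lemma sq_sum_abs_sub_le_chiSq (hP : ∑ x, P x = 1) (hQ : ∑ x, Q x = 1) (hQ0 : ∀ x, 0 ≤ Q x)
    (hPQ : ∀ x, Q x = 0 → P x = 0) :
    (∑ x, |P x - Q x|) ^ 2 ≤ ∑ x, P x ^ 2 / Q x - 1 := by
  have hexpand : ∀ x, (P x - Q x) ^ 2 / Q x = P x ^ 2 / Q x - 2 * P x + Q x := by
    intro x
    rcases eq_or_ne (Q x) 0 with h | h
    · simp [h, hPQ x h]
    · field_simp
      ring
  have hcs : (∑ x, |P x - Q x|) ^ 2 ≤ (∑ x, Q x) * ∑ x, (P x - Q x) ^ 2 / Q x := by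
    refine sum_sq_le_sum_mul_sum_of_sq_le_mul _ (fun x _ => hQ0 x)
      (fun x _ => div_nonneg (sq_nonneg _) (hQ0 x)) fun x _ => ?_
    rcases eq_or_ne (Q x) 0 with h | h
    · simp [h, hPQ x h]
    · rw [sq_abs, mul_div_cancel₀ _ h]
  calc (∑ x, |P x - Q x|) ^ 2 ≤ ∑ x, (P x ^ 2 / Q x - 2 * P x + Q x) := by
        simpa only [hQ, one_mul, hexpand] using hcs
    _ = ∑ x, P x ^ 2 / Q x - 1 := by
        rw [sum_add_distrib, sum_sub_distrib, ← mul_sum, hP, hQ]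
        ring

lemma sum_sq_div_le_exp_sq_of_abs_sub_le {δ : ℝ} (hP : ∑ x, P x = 1) (hQ : ∑ x, Q x = 1)
    (hQ0 : ∀ x, 0 ≤ Q x) (hPQ : ∀ x, |P x - Q x| ≤ δ * Q x) :
    ∑ x, P x ^ 2 / Q x ≤ Real.exp (δ ^ 2) := by
  have hpointwise : ∀ x, P x ^ 2 / Q x ≤ 2 * P x - Q x + δ ^ 2 * Q x := by
    intro x
    have hsq : (P x - Q x) ^ 2 ≤ (δ * Q x) ^ 2 :=
      sq_le_sq' (abs_le.1 (hPQ x)).1 (abs_le.1 (hPQ x)).2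
    rcases (hQ0 x).eq_or_lt with h | h
    · have hPx : P x = 0 := by simpa [← h] using hsq
      simp [← h, hPx]
    · rw [div_le_iff₀ h]
      linarith
  calc ∑ x, P x ^ 2 / Q x ≤ ∑ x, (2 * P x - Q x + δ ^ 2 * Q x) := sum_le_sum fun x _ => hpointwise x
    _ = δ ^ 2 + 1 := by
        rw [sum_add_distrib, sum_sub_distrib, ← mul_sum, ← mul_sum, hP, hQ]
        ring
    _ ≤ Real.exp (δ ^ 2) := Real.add_one_le_exp _

lemma exp_sub_one_le_two_mul {x : ℝ} (h0 : 0 ≤ x) (h1 : x ≤ 1 / 2) : Real.exp x - 1 ≤ 2 * x := by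
  have hexp : Real.exp x ≤ 1 / (1 - x) := Real.exp_bound_div_one_sub_of_interval h0 (by linarith)
  have hinv : 1 / (1 - x) ≤ 1 + 2 * x := by
    rw [div_le_iff₀ (by linarith)]
    nlinarith
  linarith

lemma sum_abs_sub_le_two (hP0 : ∀ x, 0 ≤ P x) (hQ0 : ∀ x, 0 ≤ Q x) (hP : ∑ x, P x = 1)
    (hQ : ∑ x, Q x = 1) : ∑ x, |P x - Q x| ≤ 2 := by
  calc ∑ x, |P x - Q x| ≤ ∑ x, (P x + Q x) :=
        sum_le_sum fun x _ => abs_le.2 ⟨by linarith [hP0 x], by linarith [hQ0 x]⟩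
    _ = 2 := by rw [sum_add_distrib, hP, hQ]; norm_num

lemma sq_sum_abs_prod_sub_prod_le {κ : Type*} [Fintype κ] [DecidableEq κ] {Ω : κ → Type*}
    [∀ j, Fintype (Ω j)] (P Q : ∀ j, Ω j → ℝ) (δ : κ → ℝ) (hP0 : ∀ j x, 0 ≤ P j x)
    (hQ0 : ∀ j x, 0 ≤ Q j x) (hP : ∀ j, ∑ x, P j x = 1) (hQ : ∀ j, ∑ x, Q j x = 1)
    (hPQ : ∀ j x, |P j x - Q j x| ≤ δ j * Q j x) :
    (∑ x : ∀ j, Ω j, |∏ j, P j (x j) - ∏ j, Q j (x j)|) ^ 2 ≤ 8 * ∑ j, δ j ^ 2 := by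
  have hP1 : ∑ x : ∀ j, Ω j, ∏ j, P j (x j) = 1 := by simp [← Fintype.prod_sum, hP]
  have hQ1 : ∑ x : ∀ j, Ω j, ∏ j, Q j (x j) = 1 := by simp [← Fintype.prod_sum, hQ]
  have hchi : ∑ x : ∀ j, Ω j, (∏ j, P j (x j)) ^ 2 / ∏ j, Q j (x j) ≤
      Real.exp (∑ j, δ j ^ 2) := by
    simp only [← prod_pow, ← prod_div_distrib]
    rw [← Fintype.prod_sum fun j x => P j x ^ 2 / Q j x, Real.exp_sum]
    exact prod_le_prod (fun j _ => sum_nonneg fun x _ => div_nonneg (sq_nonneg _) (hQ0 j x))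
      fun j _ => sum_sq_div_le_exp_sq_of_abs_sub_le (hP j) (hQ j) (hQ0 j) (hPQ j)
  have hac : ∀ x : ∀ j, Ω j, ∏ j, Q j (x j) = 0 → ∏ j, P j (x j) = 0 := by
    intro x hx
    obtain ⟨j, hj, hQj⟩ := prod_eq_zero_iff.1 hx
    exact prod_eq_zero hj (by simpa [hQj] using hPQ j (x j))
  have hle := sq_sum_abs_sub_le_chiSq hP1 hQ1 (fun x => prod_nonneg fun j _ => hQ0 j _) hac
  have htwo := sum_abs_sub_le_two (fun x => prod_nonneg fun j _ => hP0 j (x j))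
    (fun x => prod_nonneg fun j _ => hQ0 j (x j)) hP1 hQ1
  have hδ0 : 0 ≤ ∑ j, δ j ^ 2 := sum_nonneg fun j _ => sq_nonneg _
  rcases le_total (∑ j, δ j ^ 2) (1 / 2) with hδ | hδ
  · linarith [exp_sub_one_le_two_mul hδ0 hδ]
  · linarith [pow_le_pow_left₀ (sum_nonneg fun x _ => abs_nonneg _) htwo 2]

end ChiSquare

section MixedLaw

variable {Θ ι V : Type*} [Fintype Θ] [Fintype ι]

/-- The law of independent samples, the `i`-th with mass function `d θ i`, whose common parameter
`θ` is uniformly random. -/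
noncomputable def mixedLaw (d : Θ → ι → V → ℝ) (X : ι → V) : ℝ :=
  𝔼 θ, ∏ i, d θ i (X i)

lemma mixedLaw_nonneg {d : Θ → ι → V → ℝ} (hd : ∀ θ i v, 0 ≤ d θ i v) (X : ι → V) :
    0 ≤ mixedLaw d X :=
  expect_nonneg fun θ _ => prod_nonneg fun i _ => hd θ i _

lemma mixedLaw_const [Nonempty Θ] (q : ι → V → ℝ) (X : ι → V) :
    mixedLaw (fun _ : Θ => q) X = ∏ i, q i (X i) :=
  Fintype.expect_const _

variable [DecidableEq ι] [Fintype V]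

lemma sum_mixedLaw [Nonempty Θ] {d : Θ → ι → V → ℝ} (hd : ∀ θ i, ∑ v, d θ i v = 1) :
    ∑ X, mixedLaw d X = 1 := by
  simp [mixedLaw, ← expect_sum_comm, ← Fintype.prod_sum, hd]

lemma sum_sq_mixedLaw_div_prod (d : Θ → ι → V → ℝ) (q : ι → V → ℝ) :
    ∑ X : ι → V, mixedLaw d X ^ 2 / ∏ i, q i (X i) =
      𝔼 θ, 𝔼 θ', ∏ i, ∑ v, d θ i v * d θ' i v / q i v := by
  simp only [mixedLaw, sq, Fintype.expect_mul_expect, expect_div, ← prod_mul_distrib,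
    ← prod_div_distrib, Fintype.prod_sum, expect_sum_comm]

end MixedLaw

section TwoPoint

variable {V : Type*} [Fintype V] {n s : ℕ}

lemma sum_prod_cons_mul {W R : Type*} [Fintype W] [CommSemiring R] (g : W → R)
    (G : W → (Fin s → W) → R) :
    ∑ X : Fin (s + 1) → W, (∏ i, g (X i)) * G (X 0) (Fin.tail X) =
      ∑ w, g w * ∑ X : Fin s → W, (∏ i, g (X i)) * G w X := by
  rw [← (Fin.consEquiv fun _ : Fin (s + 1) => W).sum_comp, Fintype.sum_prod_type]
  refine sum_congr rfl fun w _ => ?_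
  rw [mul_sum]
  refine sum_congr rfl fun X _ => ?_
  simp only [Fin.consEquiv, Equiv.coe_fn_mk, Fin.prod_univ_succ, Fin.cons_zero, Fin.cons_succ,
    Fin.tail_cons, mul_assoc]

lemma sum_coe_pmf (p : PMF V) : ∑ v, p v = 1 := by
  rw [← tsum_fintype (L := .unconditional V), p.tsum_coe]

lemma sum_toReal_pmf (p : PMF V) : ∑ v, (p v).toReal = 1 := by
  rw [← ENNReal.toReal_sum fun v _ => p.apply_ne_top v, sum_coe_pmf, ENNReal.toReal_one]

/-- Each round draws one sample from each of the two distributions and the algorithm ignores the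
one it did not request, which makes the two kinds of requests symmetric. -/
lemma Algorithm.exists_acceptance (f : V → Fin n) (T : Algorithm n) (hs : T.DrawsAtMost s) :
    ∃ F : (Fin s → V × V) → ENNReal, (∀ X, F X ≤ 1) ∧ ∀ p q : PMF V,
      T.run (p.map f) (q.map f) true = ∑ X, (∏ i, p (X i).1 * q (X i).2) * F X := by
  have hmass : ∀ p q : PMF V, ∑ v : V × V, p v.1 * q v.2 = 1 := fun p q => by
    simp only [Fintype.sum_prod_type, ← mul_sum, sum_coe_pmf, mul_one]
  induction T generalizing s with
  | output b =>
    refine ⟨fun _ => if b then 1 else 0, fun _ => by split_ifs <;> simp, fun p q => ?_⟩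
    rw [← sum_mul, ← Fintype.prod_sum fun (_ : Fin s) (v : V × V) => p v.1 * q v.2]
    cases b <;> simp [Algorithm.run, hmass]
  | coin μ next ih =>
    choose F hF1 hF using fun j => ih j (hs j)
    refine ⟨fun X => ∑' j, μ j * F j X, fun X => ?_, fun p q => ?_⟩
    · calc ∑' j, μ j * F j X ≤ ∑' j, μ j :=
            ENNReal.tsum_le_tsum fun j => mul_le_of_le_one_right' (hF1 j X)
        _ = 1 := μ.tsum_coe
    · simp only [Algorithm.run, PMF.bind_apply, hF, ← ENNReal.tsum_mul_left, mul_sum]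
      rw [Summable.tsum_finsetSum fun _ _ => ENNReal.summable]
      exact sum_congr rfl fun X _ => tsum_congr fun j => mul_left_comm ..
  | sampleP next ih =>
    cases s with
    | zero => exact hs.elim
    | succ s =>
      choose F hF1 hF using fun x => ih x (hs x)
      refine ⟨fun X => F (f (X 0).1) (Fin.tail X), fun X => hF1 .., fun p q => ?_⟩
      rw [sum_prod_cons_mul (fun v : V × V => p v.1 * q v.2) fun v X => F (f v.1) X,
        Fintype.sum_prod_type]
      simp only [Algorithm.run, PMF.bind_map, PMF.bind_apply, tsum_fintype, Function.comp, hF,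
        ← sum_mul, ← mul_sum, sum_coe_pmf, mul_one]
  | sampleQ next ih =>
    cases s with
    | zero => exact hs.elim
    | succ s =>
      choose F hF1 hF using fun x => ih x (hs x)
      refine ⟨fun X => F (f (X 0).2) (Fin.tail X), fun X => hF1 .., fun p q => ?_⟩
      rw [sum_prod_cons_mul (fun v : V × V => p v.1 * q v.2) fun v X => F (f v.2) X,
        Fintype.sum_prod_type_right]
      simp only [Algorithm.run, PMF.bind_map, PMF.bind_apply, tsum_fintype, Function.comp, hF,
        ← sum_mul, sum_coe_pmf, one_mul]

/-- The mass functions of `2s` samples, the first half drawn from `p` and the second from `q`. -/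
noncomputable def sampleMass (s : ℕ) (p q : PMF V) : Fin s ⊕ Fin s → V → ℝ :=
  Sum.elim (fun _ v => (p v).toReal) fun _ v => (q v).toReal

lemma sum_sampleMass (p q : PMF V) (i : Fin s ⊕ Fin s) : ∑ v, sampleMass s p q i v = 1 := by
  rcases i with _ | _
  · exact sum_toReal_pmf p
  · exact sum_toReal_pmf q

lemma Algorithm.exists_acceptance_real (f : V → Fin n) (T : Algorithm n) (hs : T.DrawsAtMost s) :
    ∃ F : (Fin s ⊕ Fin s → V) → ℝ, (∀ X, |F X| ≤ 1) ∧ ∀ p q : PMF V,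
      (T.run (p.map f) (q.map f) true).toReal = ∑ X, (∏ i, sampleMass s p q i (X i)) * F X := by
  obtain ⟨F, hF1, hF⟩ := T.exists_acceptance f hs
  let pairing : (Fin s ⊕ Fin s → V) ≃ (Fin s → V × V) :=
    (Equiv.sumArrowEquivProdArrow _ _ _).trans (Equiv.arrowProdEquivProdArrow _ _ _).symm
  refine ⟨fun X => (F (pairing X)).toReal, fun X => ?_, fun p q => ?_⟩
  · rw [abs_of_nonneg ENNReal.toReal_nonneg]
    exact ENNReal.toReal_le_of_le_ofReal zero_le_one (by simpa using hF1 _)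
  · have hfinite : ∀ X, (∏ i, p (X i).1 * q (X i).2) * F X ≠ ⊤ := fun X =>
      ENNReal.mul_ne_top
        (ENNReal.prod_ne_top fun i _ => ENNReal.mul_ne_top (p.apply_ne_top _) (q.apply_ne_top _))
        (ne_top_of_le_ne_top ENNReal.one_ne_top (hF1 X))
    rw [hF, ENNReal.toReal_sum fun X _ => hfinite X, ← pairing.sum_comp]
    refine sum_congr rfl fun X _ => ?_
    rw [ENNReal.toReal_mul, ENNReal.toReal_prod, Fintype.prod_sum_type, ← prod_mul_distrib]
    simp only [ENNReal.toReal_mul]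
    rfl

lemma IsClosenessTester.one_third_le_toReal_run_sub {η p₀ q₀ p₁ q₁ : PMF (Fin n)} {ε : ℝ}
    {T : Algorithm n} (hT : IsClosenessTester η ε T) (hyes : p₀ ∈ mixtures q₀ η)
    (hno : IsFar ε p₁ (mixtures q₁ η)) :
    1 / 3 ≤ (T.run p₀ q₀ true).toReal - (T.run p₁ q₁ true).toReal := by
  have haccept := ENNReal.toReal_mono (PMF.apply_ne_top _ _) ((hT p₀ q₀).1 hyes)
  have hreject := ENNReal.toReal_mono (PMF.apply_ne_top _ _) ((hT p₁ q₁).2 hno)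
  have hmass := sum_toReal_pmf (T.run p₁ q₁)
  rw [Fintype.sum_bool] at hmass
  rw [ENNReal.toReal_div, ENNReal.toReal_ofNat, ENNReal.toReal_ofNat] at haccept hreject
  linarith

lemma IsClosenessTester.one_third_le_sum_abs_mixedLaw_sub {η : PMF (Fin n)} {ε : ℝ}
    {T : Algorithm n} (hT : IsClosenessTester η ε T) (hs : T.DrawsAtMost s) {Θ : Type*} [Fintype Θ]
    [Nonempty Θ] (f : V → Fin n) {p₀ q₀ p₁ q₁ : Θ → PMF V}
    (hyes : ∀ θ, (p₀ θ).map f ∈ mixtures ((q₀ θ).map f) η)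
    (hno : ∀ θ, IsFar ε ((p₁ θ).map f) (mixtures ((q₁ θ).map f) η)) :
    1 / 3 ≤ ∑ X, |mixedLaw (fun θ => sampleMass s (p₀ θ) (q₀ θ)) X -
      mixedLaw (fun θ => sampleMass s (p₁ θ) (q₁ θ)) X| := by
  obtain ⟨F, hF1, hF⟩ := T.exists_acceptance_real f hs
  have hlaw : ∀ p q : Θ → PMF V, 𝔼 θ, (T.run ((p θ).map f) ((q θ).map f) true).toReal =
      ∑ X, mixedLaw (fun θ => sampleMass s (p θ) (q θ)) X * F X := fun p q => by
    simp only [hF, mixedLaw, expect_sum_comm, expect_mul]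
  calc (1 / 3 : ℝ) ≤ 𝔼 θ, ((T.run ((p₀ θ).map f) ((q₀ θ).map f) true).toReal -
        (T.run ((p₁ θ).map f) ((q₁ θ).map f) true).toReal) :=
        le_expect univ_nonempty fun θ _ => hT.one_third_le_toReal_run_sub (hyes θ) (hno θ)
    _ = ∑ X, (mixedLaw (fun θ => sampleMass s (p₀ θ) (q₀ θ)) X -
        mixedLaw (fun θ => sampleMass s (p₁ θ) (q₁ θ)) X) * F X := by
        simp only [expect_sub_distrib, hlaw, sub_mul, sum_sub_distrib]
    _ ≤ _ := sum_le_sum fun X _ => (le_abs_self _).trans <| by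
        rw [abs_mul]
        exact mul_le_of_le_one_right (abs_nonneg _) (hF1 X)

end TwoPoint

section FarFromMixtures

variable {V : Type*} [Fintype V] {n : ℕ}

lemma exists_pmf_toReal_eq {d : V → ℝ} (h0 : ∀ v, 0 ≤ d v) (h1 : ∑ v, d v = 1) :
    ∃ p : PMF V, ∀ v, (p v).toReal = d v := by
  refine ⟨PMF.ofFintype (fun v => ENNReal.ofReal (d v)) ?_, fun v => ?_⟩
  · rw [← ENNReal.ofReal_sum_of_nonneg fun v _ => h0 v, h1, ENNReal.ofReal_one]
  · rw [PMF.ofFintype_apply, ENNReal.toReal_ofReal (h0 v)]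

lemma self_mem_mixtures (p η : PMF (Fin n)) : p ∈ mixtures p η :=
  ⟨0, by simp, fun i => by ring⟩

lemma sum_map_toReal_mul (p : PMF V) (f : V → Fin n) (g : Fin n → ℝ) :
    ∑ x, (p.map f x).toReal * g x = ∑ v, (p v).toReal * g (f v) := by
  classical
  have hmap : ∀ x, (p.map f x).toReal = ∑ v, if x = f v then (p v).toReal else 0 := by
    intro x
    rw [PMF.map_apply, tsum_fintype, ENNReal.toReal_sum]
    · exact sum_congr rfl fun v _ => by split_ifs <;> simp
    · intro v _
      split_ifs
      · exact p.apply_ne_top _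
      · exact ENNReal.zero_ne_top
  simp only [hmap, sum_mul, ite_mul, zero_mul]
  rw [sum_comm]
  simp only [sum_ite_eq', mem_univ, if_true]

lemma sum_mul_sub_le_l1Dist (p r : PMF (Fin n)) {φ : Fin n → ℝ} (hφ : ∀ x, |φ x| ≤ 1) :
    ∑ x, (p x).toReal * φ x - ∑ x, (r x).toReal * φ x ≤ l1Dist p r := by
  rw [← sum_sub_distrib, l1Dist]
  refine sum_le_sum fun x _ => ?_
  rw [← sub_mul]
  refine (le_abs_self _).trans ?_
  rw [abs_mul]
  exact mul_le_of_le_one_right (abs_nonneg _) (hφ x)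

lemma isFar_mixtures_of_sum_mul_le {p q η : PMF (Fin n)} {φ : Fin n → ℝ} {a b : ℝ}
    (hφ : ∀ x, |φ x| ≤ 1) (hp : a ≤ ∑ x, (p x).toReal * φ x) (hq : ∑ x, (q x).toReal * φ x ≤ b)
    (hη : ∑ x, (η x).toReal * φ x ≤ b) : IsFar (a - b) p (mixtures q η) := by
  rintro r ⟨α, ⟨hα0, hα1⟩, hr⟩
  have hmix : ∑ x, (r x).toReal * φ x =
      (1 - α) * ∑ x, (q x).toReal * φ x + α * ∑ x, (η x).toReal * φ x := by
    simp only [hr, add_mul, sum_add_distrib, mul_assoc, mul_sum]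
  have hle : ∑ x, (r x).toReal * φ x ≤ b := by
    rw [hmix]
    nlinarith
  linarith [sum_mul_sub_le_l1Dist p r hφ]

/-- The test function is extended by `-1` outside the range of `f`, so that the part of `[n]` not
covered by `V` only helps against the uniform noise. -/
lemma isFar_map_mixtures_uniform [NeZero n] (f : V ↪ Fin n) {p q : PMF V} {φ : V → ℝ} {a b : ℝ}
    (hφ : ∀ v, |φ v| ≤ 1) (hp : a ≤ ∑ v, (p v).toReal * φ v) (hq : ∑ v, (q v).toReal * φ v ≤ b)
    (hsum : ∑ v, (φ v + 1) ≤ (1 + b) * n) :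
    IsFar (a - b) (p.map f) (mixtures (q.map f) (PMF.uniformOfFintype (Fin n))) := by
  set ψ : Fin n → ℝ := Function.extend f φ fun _ => -1
  have hψf : ∀ v, ψ (f v) = φ v := fun v => f.injective.extend_apply φ _ v
  have hψ : ∀ x, (∃ v, f v = x) ∨ ψ x = -1 := fun x =>
    or_iff_not_imp_left.2 (Function.extend_apply' φ _ x)
  have hext : ∑ x, (ψ x + 1) = ∑ v, (φ v + 1) := by
    refine (Fintype.sum_of_injective f f.injective _ _ (fun x hx => ?_) fun v => ?_).symm
    · rw [(hψ x).resolve_left hx, neg_add_cancel]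
    · rw [hψf]
  have hn : (0 : ℝ) < n := Nat.cast_pos.2 (NeZero.pos n)
  refine isFar_mixtures_of_sum_mul_le (φ := ψ) (fun x => ?_) ?_ ?_ ?_
  · rcases hψ x with ⟨v, rfl⟩ | hx
    · exact (hψf v).symm ▸ hφ v
    · rw [hx, abs_neg, abs_one]
  · simpa only [sum_map_toReal_mul, hψf] using hp
  · simpa only [sum_map_toReal_mul, hψf] using hq
  · have hψsum : ∑ x, ψ x ≤ b * n := by
      rw [sum_add_distrib] at hext
      simp only [sum_const, card_univ, Fintype.card_fin, nsmul_eq_mul, mul_one] at hext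
      linarith
    simp only [PMF.uniformOfFintype_apply, Fintype.card_fin, ENNReal.toReal_inv,
      ENNReal.toReal_natCast, ← mul_sum]
    rwa [inv_mul_le_iff₀ hn, mul_comm]

end FarFromMixtures

section Signs

/-- A Boolean read as a sign, with `true` standing for `1`. -/
def boolSign (b : Bool) : ℝ := if b then 1 else -1

lemma abs_boolSign (b : Bool) : |boolSign b| = 1 := by cases b <;> simp [boolSign]

lemma boolSign_sq (b : Bool) : boolSign b ^ 2 = 1 := by rw [← sq_abs, abs_boolSign, one_pow]

lemma sum_boolSign : ∑ b, boolSign b = 0 := by simp [boolSign]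

lemma expect_exp_sum_mul_boolSign_le {ι : Type*} [Fintype ι] [DecidableEq ι] (x : ι → ℝ) :
    𝔼 z : ι → Bool, Real.exp (∑ i, x i * boolSign (z i)) ≤ Real.exp (∑ i, x i ^ 2 / 2) := by
  have hcosh : ∀ i, 𝔼 b, Real.exp (x i * boolSign b) = Real.cosh (x i) := fun i => by
    rw [Fintype.expect_eq_sum_div_card, Fintype.sum_bool, Real.cosh_eq]
    simp [boolSign]
  simp only [Real.exp_sum]
  rw [expect_pi_prod fun i b => Real.exp (x i * boolSign b)]
  simp only [hcosh]
  exact prod_le_prod (fun i _ => (Real.cosh_pos _).le) fun i _ => Real.cosh_le_exp_half_sq _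

end Signs

section Uniformity

variable {m : ℕ}

/-- The pattern on `m` pairs of domain elements that is antisymmetric on each pair, with
orientation given by `z`. -/
def pairSign (z : Fin m → Bool) (v : Fin m × Bool) : ℝ := boolSign (z v.1) * boolSign v.2

/-- The uniform mass function on `m` pairs, tilted by `ε` in the direction of `pairSign z`. -/
noncomputable def tiltedMass (ε : ℝ) (z : Fin m → Bool) (v : Fin m × Bool) : ℝ :=
  (1 + ε * pairSign z v) / (2 * m)

lemma abs_pairSign (z : Fin m → Bool) (v : Fin m × Bool) : |pairSign z v| = 1 := by
  rw [pairSign, abs_mul, abs_boolSign, abs_boolSign, one_mul]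

lemma sum_pairSign (z : Fin m → Bool) : ∑ v, pairSign z v = 0 := by
  simp only [Fintype.sum_prod_type, pairSign, ← mul_sum, sum_boolSign, mul_zero, sum_const_zero]

lemma sum_pairSign_mul_pairSign (z z' : Fin m → Bool) :
    ∑ v, pairSign z v * pairSign z' v = 2 * ∑ j, boolSign (z j) * boolSign (z' j) := by
  have hterm : ∀ v : Fin m × Bool, pairSign z v * pairSign z' v =
      boolSign (z v.1) * boolSign (z' v.1) := fun v => by
    rw [pairSign, pairSign, mul_mul_mul_comm, ← sq (boolSign v.2), boolSign_sq, mul_one]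
  simp only [Fintype.sum_prod_type, hterm, sum_const, card_univ, Fintype.card_bool, mul_sum,
    nsmul_eq_mul, Nat.cast_ofNat]

lemma tiltedMass_nonneg {ε : ℝ} (h0 : 0 ≤ ε) (h1 : ε ≤ 1) (z : Fin m → Bool) (v : Fin m × Bool) :
    0 ≤ tiltedMass ε z v := by
  have hlow := (abs_le.1 (abs_pairSign z v).le).1
  exact div_nonneg (by nlinarith) (by positivity)

variable [NeZero m]

lemma sum_tiltedMass (ε : ℝ) (z : Fin m → Bool) : ∑ v, tiltedMass ε z v = 1 := by
  have hm : (m : ℝ) ≠ 0 := NeZero.ne _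
  simp only [tiltedMass, ← sum_div, sum_add_distrib, ← mul_sum, sum_pairSign, sum_const, card_univ,
    Fintype.card_prod, Fintype.card_fin, Fintype.card_bool, nsmul_eq_mul]
  push_cast
  field_simp
  ring

lemma sum_tiltedMass_mul_pairSign (ε : ℝ) (z : Fin m → Bool) :
    ∑ v, tiltedMass ε z v * pairSign z v = ε := by
  have hm : (m : ℝ) ≠ 0 := NeZero.ne _
  have hterm : ∀ v, tiltedMass ε z v * pairSign z v = (pairSign z v + ε) / (2 * m) := fun v => by
    have hsq : pairSign z v ^ 2 = 1 := by rw [← sq_abs, abs_pairSign, one_pow]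
    rw [tiltedMass, div_mul_eq_mul_div, add_mul, one_mul, mul_assoc, ← sq, hsq, mul_one]
  simp only [hterm, ← sum_div, sum_add_distrib, sum_pairSign, sum_const, card_univ,
    Fintype.card_prod, Fintype.card_fin, Fintype.card_bool, nsmul_eq_mul]
  push_cast
  field_simp
  ring

lemma sum_tiltedMass_mul_div (ε : ℝ) (z z' z₀ : Fin m → Bool) :
    ∑ v, tiltedMass ε z v * tiltedMass ε z' v / tiltedMass 0 z₀ v =
      1 + ε ^ 2 / m * ∑ j, boolSign (z j) * boolSign (z' j) := by
  have hm : (m : ℝ) ≠ 0 := NeZero.ne _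
  have hterm : ∀ v, tiltedMass ε z v * tiltedMass ε z' v / tiltedMass 0 z₀ v =
      tiltedMass ε z v + ε / (2 * m) * pairSign z' v +
        ε ^ 2 / (2 * m) * (pairSign z v * pairSign z' v) := fun v => by
    simp only [tiltedMass]
    field_simp
    ring
  simp only [hterm, sum_add_distrib, sum_tiltedMass, ← mul_sum, sum_pairSign,
    sum_pairSign_mul_pairSign]
  field_simp
  ring

lemma expect_expect_pow_le (s : ℕ) {ε : ℝ} (h0 : 0 ≤ ε) (h1 : ε ≤ 1) :
    𝔼 z : Fin m → Bool, 𝔼 z' : Fin m → Bool,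
      (1 + ε ^ 2 / m * ∑ j, boolSign (z j) * boolSign (z' j)) ^ s ≤
        Real.exp (s ^ 2 * ε ^ 4 / (2 * m)) := by
  have hm : (m : ℝ) ≠ 0 := NeZero.ne _
  refine expect_le univ_nonempty fun z _ => ?_
  calc 𝔼 z' : Fin m → Bool, (1 + ε ^ 2 / m * ∑ j, boolSign (z j) * boolSign (z' j)) ^ s
      ≤ 𝔼 z' : Fin m → Bool,
          Real.exp (∑ j, s * (ε ^ 2 / m * boolSign (z j)) * boolSign (z' j)) := by
        refine expect_le_expect fun z' _ => ?_
        have hnonneg : 0 ≤ 1 + ε ^ 2 / m * ∑ j, boolSign (z j) * boolSign (z' j) := by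
          rw [← sum_tiltedMass_mul_div ε z z' z]
          exact sum_nonneg fun v _ => div_nonneg
            (mul_nonneg (tiltedMass_nonneg h0 h1 _ _) (tiltedMass_nonneg h0 h1 _ _))
            (tiltedMass_nonneg le_rfl zero_le_one _ _)
        rw [add_comm] at hnonneg ⊢
        refine (pow_le_pow_left₀ hnonneg (Real.add_one_le_exp _) s).trans_eq ?_
        simp only [← Real.exp_nat_mul, mul_sum, mul_assoc]
    _ ≤ Real.exp (∑ j, (s * (ε ^ 2 / m * boolSign (z j))) ^ 2 / 2) :=
        expect_exp_sum_mul_boolSign_le _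
    _ = Real.exp (s ^ 2 * ε ^ 4 / (2 * m)) := by
        simp only [mul_pow, boolSign_sq, sum_const, card_univ, Fintype.card_fin, nsmul_eq_mul]
        congr 1
        field_simp

lemma sq_sum_abs_mixedLaw_tiltedMass_sub_le {s : ℕ} {ε : ℝ} (h0 : 0 ≤ ε) (h1 : ε ≤ 1)
    {p : (Fin m → Bool) → PMF (Fin m × Bool)} {u : PMF (Fin m × Bool)}
    (hp : ∀ z v, (p z v).toReal = tiltedMass ε z v)
    (hu : ∀ z v, (u v).toReal = tiltedMass 0 z v) :
    (∑ X, |mixedLaw (fun _ : Fin m → Bool => sampleMass s u u) X -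
      mixedLaw (fun z => sampleMass s (p z) u) X|) ^ 2 ≤
        Real.exp (s ^ 2 * ε ^ 4 / (2 * m)) - 1 := by
  have hm : 0 < (m : ℝ) := Nat.cast_pos.2 (NeZero.pos m)
  have hu_pos : ∀ v, 0 < (u v).toReal := fun v => by
    rw [hu fun _ => true, tiltedMass, zero_mul, add_zero]
    positivity
  have hpos : ∀ i v, 0 < sampleMass s u u i v := by
    rintro (_ | _) v <;> exact hu_pos v
  have hchi : ∀ z z', ∏ i, ∑ v, sampleMass s (p z) u i v * sampleMass s (p z') u i v /
      sampleMass s u u i v = (1 + ε ^ 2 / m * ∑ j, boolSign (z j) * boolSign (z' j)) ^ s := by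
    intro z z'
    have hq : ∀ v, (u v).toReal * (u v).toReal / (u v).toReal = (u v).toReal := fun v =>
      mul_div_cancel_right₀ _ (hu_pos v).ne'
    simp only [Fintype.prod_sum_type, sampleMass, Sum.elim_inl, Sum.elim_inr, hq, sum_toReal_pmf]
    simp only [hp, hu z, sum_tiltedMass_mul_div, prod_const, card_univ, Fintype.card_fin, one_pow,
      mul_one]
  calc (∑ X, |mixedLaw (fun _ => sampleMass s u u) X -
        mixedLaw (fun z => sampleMass s (p z) u) X|) ^ 2
      = (∑ X, |mixedLaw (fun z => sampleMass s (p z) u) X -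
          ∏ i, sampleMass s u u i (X i)|) ^ 2 := by
        simp only [mixedLaw_const, abs_sub_comm]
    _ ≤ ∑ X, mixedLaw (fun z => sampleMass s (p z) u) X ^ 2 / ∏ i, sampleMass s u u i (X i) - 1 :=
        sq_sum_abs_sub_le_chiSq (sum_mixedLaw fun z => sum_sampleMass _ _)
          (by simp only [← Fintype.prod_sum, sum_sampleMass, prod_const_one])
          (fun X => prod_nonneg fun i _ => (hpos i _).le)
          fun X hX => absurd hX (prod_pos fun i _ => hpos i _).ne'
    _ ≤ Real.exp (s ^ 2 * ε ^ 4 / (2 * m)) - 1 := by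
        rw [sum_sq_mixedLaw_div_prod]
        simp only [hchi]
        exact sub_le_sub_right (expect_expect_pow_le s h0 h1) 1

lemma isFar_map_tiltedMass {n : ℕ} [NeZero n] (f : Fin m × Bool ↪ Fin n) (hn : 2 * m ≤ n) {ε : ℝ}
    (z : Fin m → Bool) {p u : PMF (Fin m × Bool)} (hp : ∀ v, (p v).toReal = tiltedMass ε z v)
    (hu : ∀ v, (u v).toReal = tiltedMass 0 z v) :
    IsFar ε (p.map f) (mixtures (u.map f) (PMF.uniformOfFintype (Fin n))) := by
  rw [← sub_zero ε]
  refine isFar_map_mixtures_uniform f (φ := pairSign z) (fun v => (abs_pairSign z v).le) ?_ ?_ ?_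
  · simp only [hp, sum_tiltedMass_mul_pairSign, le_refl]
  · simp only [hu, sum_tiltedMass_mul_pairSign, le_refl]
  · have hn' : (2 * m : ℝ) ≤ n := by exact_mod_cast hn
    rw [sum_add_distrib, sum_pairSign]
    simpa [mul_comm] using hn'

lemma IsClosenessTester.card_le_of_drawsAtMost {n s : ℕ} [NeZero n] (hn : 2 ≤ n) {ε : ℝ}
    (h0 : 0 ≤ ε) (h1 : ε ≤ 1) {T : Algorithm n}
    (hT : IsClosenessTester (PMF.uniformOfFintype (Fin n)) ε T) (hs : T.DrawsAtMost s) :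
    (n : ℝ) ≤ 27 * s ^ 2 * ε ^ 4 := by
  obtain ⟨m, hm⟩ : ∃ m, m = n / 2 := ⟨_, rfl⟩
  have : NeZero m := ⟨by lia⟩
  have hnm : (n : ℝ) ≤ 3 * m := by exact_mod_cast (by lia : n ≤ 3 * m)
  obtain ⟨f⟩ : Nonempty (Fin m × Bool ↪ Fin n) := Function.Embedding.nonempty_of_card_le <| by
    simp only [Fintype.card_prod, Fintype.card_fin, Fintype.card_bool]
    lia
  choose p hp using fun z : Fin m → Bool =>
    exists_pmf_toReal_eq (tiltedMass_nonneg h0 h1 z) (sum_tiltedMass ε z)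
  obtain ⟨u, hu⟩ := exists_pmf_toReal_eq
    (tiltedMass_nonneg le_rfl zero_le_one fun _ : Fin m => true) (sum_tiltedMass 0 _)
  have hu' : ∀ z v, (u v).toReal = tiltedMass 0 z v := fun z v => by
    rw [hu, tiltedMass, tiltedMass, zero_mul, zero_mul]
  have hgap := hT.one_third_le_sum_abs_mixedLaw_sub hs f (p₀ := fun _ => u) (q₀ := fun _ => u)
    (p₁ := p) (q₁ := fun _ => u) (fun _ => self_mem_mixtures _ _)
    fun z => isFar_map_tiltedMass f (by lia) z (hp z) (hu' z)
  have hsq := (pow_le_pow_left₀ (by norm_num) hgap 2).trans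
    (sq_sum_abs_mixedLaw_tiltedMass_sub_le h0 h1 hp hu')
  have hlarge : 1 / 18 ≤ s ^ 2 * ε ^ 4 / (2 * m) := by
    by_contra! hsmall
    linarith [exp_sub_one_le_two_mul (by positivity) (hsmall.le.trans (by norm_num))]
  have hm_pos : 0 < (m : ℝ) := Nat.cast_pos.2 (NeZero.pos m)
  rw [le_div_iff₀ (by positivity)] at hlarge
  linarith

end Uniformity

section Block

/-- The conditional law of the label of a sample from a light pair, relative to the orientation of
the pair. -/
noncomputable def lightMass (b : Bool) : ℝ := if b then 1 / 8 else 7 / 8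

lemma lightMass_pos (b : Bool) : 0 < lightMass b := by cases b <;> norm_num [lightMass]

lemma lightMass_le_one (b : Bool) : lightMass b ≤ 1 := by cases b <;> norm_num [lightMass]

lemma lightMass_le_eight_mul (b b' : Bool) : lightMass b ≤ 8 * lightMass b' := by
  cases b <;> cases b' <;> norm_num [lightMass]

variable {D M : ℕ}

/-- The law of the latent component of a sample: light (`none`), with probability `ε`, or the heavy
pair of index `g` (`some g`), in the proportions `w`. -/
def latentMass (ε : ℝ) (w : Fin D → ℝ) : Option (Fin D) → ℝ
  | none => ε
  | some g => (1 - ε) * w g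

/-- The factor of the conditional law of a sample, given its latent component, that depends on the
positions `h` of the heavy pairs. -/
noncomputable def heavyKernel (h : Fin D → Fin M) : Option (Fin D) → Fin M × Bool → ℝ
  | none, _ => 1
  | some g, y => if h g = y.1 then 1 / 2 else 0

/-- The factor of the conditional law of a sample, given its latent component, that depends on the
orientations `z` of the light pairs; `σ` reverses all orientations. -/
noncomputable def lightKernel (z : Fin M → Bool) (σ : Bool) : Option (Fin D) → Fin M × Bool → ℝ
  | none, y => lightMass (y.2 ^^ (z y.1 ^^ σ)) / M
  | some _, _ => 1

/-- The mass function of a block of `M` pairs: mass `1 - ε` is carried by the heavy pairs, at the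
positions `θ.1` and in the proportions `w`, and mass `ε` is spread over all pairs, oriented by `θ.2`
or, if `σ` holds, by its negation. -/
noncomputable def blockMass (ε : ℝ) (w : Fin D → ℝ) (θ : (Fin D → Fin M) × (Fin M → Bool))
    (σ : Bool) (y : Fin M × Bool) : ℝ :=
  ∑ a, latentMass ε w a * (heavyKernel θ.1 a y * lightKernel θ.2 σ a y)

lemma latentMass_none (ε : ℝ) (w : Fin D → ℝ) : latentMass ε w none = ε := rfl

lemma latentMass_some (ε : ℝ) (w : Fin D → ℝ) (g : Fin D) :
    latentMass ε w (some g) = (1 - ε) * w g := rfl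

lemma heavyKernel_none (h : Fin D → Fin M) (y : Fin M × Bool) : heavyKernel h none y = 1 := rfl

lemma heavyKernel_some (h : Fin D → Fin M) (g : Fin D) (y : Fin M × Bool) :
    heavyKernel h (some g) y = if h g = y.1 then 1 / 2 else 0 := rfl

lemma lightKernel_none (z : Fin M → Bool) (σ : Bool) (y : Fin M × Bool) :
    lightKernel (D := D) z σ none y = lightMass (y.2 ^^ (z y.1 ^^ σ)) / M := rfl

lemma lightKernel_some (z : Fin M → Bool) (σ : Bool) (g : Fin D) (y : Fin M × Bool) :
    lightKernel z σ (some g) y = 1 := rfl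

lemma latentMass_nonneg {ε : ℝ} {w : Fin D → ℝ} (h0 : 0 ≤ ε) (h1 : ε ≤ 1) (hw : ∀ g, 0 ≤ w g) :
    ∀ a, 0 ≤ latentMass ε w a
  | none => h0
  | some g => mul_nonneg (sub_nonneg.2 h1) (hw g)

lemma heavyKernel_nonneg (h : Fin D → Fin M) (y : Fin M × Bool) : ∀ a, 0 ≤ heavyKernel h a y
  | none => zero_le_one
  | some g => by
    rw [heavyKernel_some]
    positivity

lemma lightKernel_nonneg (z : Fin M → Bool) (σ : Bool) (y : Fin M × Bool) :
    ∀ a : Option (Fin D), 0 ≤ lightKernel z σ a y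
  | none => div_nonneg (lightMass_pos _).le (Nat.cast_nonneg _)
  | some _ => zero_le_one

lemma lightKernel_le_eight_mul (z : Fin M → Bool) (σ σ' : Bool) (y : Fin M × Bool) :
    ∀ a : Option (Fin D), lightKernel z σ a y ≤ 8 * lightKernel z σ' a y
  | none => by
    rw [lightKernel_none, lightKernel_none, ← mul_div_assoc]
    exact div_le_div_of_nonneg_right (lightMass_le_eight_mul _ _) (Nat.cast_nonneg _)
  | some _ => by norm_num [lightKernel_some]

lemma lightKernel_none_le (z : Fin M → Bool) (σ : Bool) (y : Fin M × Bool) :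
    lightKernel (D := D) z σ none y ≤ 1 / M :=
  div_le_div_of_nonneg_right (lightMass_le_one _) (Nat.cast_nonneg _)

lemma blockMass_nonneg {ε : ℝ} {w : Fin D → ℝ} (h0 : 0 ≤ ε) (h1 : ε ≤ 1) (hw : ∀ g, 0 ≤ w g)
    (θ : (Fin D → Fin M) × (Fin M → Bool)) (σ : Bool) (y : Fin M × Bool) :
    0 ≤ blockMass ε w θ σ y :=
  sum_nonneg fun a _ => mul_nonneg (latentMass_nonneg h0 h1 hw a)
    (mul_nonneg (heavyKernel_nonneg _ _ _) (lightKernel_nonneg _ _ _ _))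

lemma sum_blockMass_mul (ε : ℝ) (w : Fin D → ℝ) (θ : (Fin D → Fin M) × (Fin M → Bool)) (σ : Bool)
    (φ : Fin M × Bool → ℝ) :
    ∑ y, blockMass ε w θ σ y * φ y =
      ε * 𝔼 v, ∑ b, lightMass (b ^^ (θ.2 v ^^ σ)) * φ (v, b) +
        (1 - ε) * ∑ g, w g * 𝔼 b, φ (θ.1 g, b) := by
  simp only [blockMass, sum_mul]
  rw [sum_comm, Fintype.sum_option]
  congr 1
  · simp only [latentMass_none, heavyKernel_none, lightKernel_none, one_mul, Fintype.sum_prod_type,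
      mul_assoc, ← mul_sum, Fintype.expect_eq_sum_div_card, Fintype.card_fin, sum_div,
      div_mul_eq_mul_div]
  · rw [mul_sum]
    refine sum_congr rfl fun g _ => ?_
    simp only [latentMass_some, heavyKernel_some, lightKernel_some, mul_one, Fintype.sum_prod_type,
      Fintype.expect_eq_sum_div_card, Fintype.card_bool]
    rw [sum_eq_single (θ.1 g) (fun v _ hv => by simp [hv.symm]) (by simp)]
    simp only [if_true, Fintype.sum_bool]
    push_cast
    ring

lemma sum_blockMass [NeZero M] (ε : ℝ) {w : Fin D → ℝ} (hw : ∑ g, w g = 1)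
    (θ : (Fin D → Fin M) × (Fin M → Bool)) (σ : Bool) : ∑ y, blockMass ε w θ σ y = 1 := by
  have hlight : ∀ t, ∑ b, lightMass (b ^^ t) = 1 := fun t => by
    cases t <;> norm_num [lightMass]
  simpa only [mul_one, hlight, Fintype.expect_const, hw, add_sub_cancel] using
    sum_blockMass_mul ε w θ σ fun _ => 1

lemma sum_blockMass_mul_boolSign [NeZero M] (ε : ℝ) (w : Fin D → ℝ)
    (θ : (Fin D → Fin M) × (Fin M → Bool)) (σ : Bool) :
    ∑ y, blockMass ε w θ σ y * boolSign (y.2 ^^ θ.2 y.1) = 3 / 4 * ε * boolSign σ := by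
  have hlight : ∀ v, ∑ b, lightMass (b ^^ (θ.2 v ^^ σ)) * boolSign (b ^^ θ.2 v) =
      3 / 4 * boolSign σ := fun v => by
    cases θ.2 v <;> cases σ <;> norm_num [lightMass, boolSign]
  have hheavy : ∀ v, 𝔼 b, boolSign (b ^^ θ.2 v) = 0 := fun v => by
    rw [Fintype.expect_eq_sum_div_card]
    cases θ.2 v <;> norm_num [boolSign]
  rw [sum_blockMass_mul]
  simp only [hlight, hheavy, Fintype.expect_const, mul_zero, sum_const_zero, add_zero]
  ring

end Block

section LatentDecomposition

variable {D M : ℕ} {A : Type*} [Fintype A]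

/-- The likelihood of the samples `y` given their latent components `a`, up to the factor accounting
for the light components, when the positions of the heavy pairs are uniformly random. -/
noncomputable def heavyWeight (a : A → Option (Fin D)) (y : A → Fin M × Bool) : ℝ :=
  𝔼 h : Fin D → Fin M, ∏ i, heavyKernel h (a i) (y i)

/-- The likelihood of the samples `y` given their latent components `a`, up to the factor accounting
for the heavy components, when the orientations of the light pairs are uniformly random; those of
the samples selected by `c` are reversed. -/
noncomputable def lightWeight (c : A → Bool) (a : A → Option (Fin D)) (y : A → Fin M × Bool) : ℝ :=
  𝔼 z : Fin M → Bool, ∏ i, lightKernel z (c i) (a i) (y i)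

/-- The joint law of the samples `y` from a random block and of their latent components `a`. -/
noncomputable def jointLaw (ε : ℝ) (w : Fin D → ℝ) (c : A → Bool) (y : A → Fin M × Bool)
    (a : A → Option (Fin D)) : ℝ :=
  (∏ i, latentMass ε w (a i)) * (heavyWeight a y * lightWeight c a y)

lemma heavyWeight_nonneg (a : A → Option (Fin D)) (y : A → Fin M × Bool) : 0 ≤ heavyWeight a y :=
  expect_nonneg fun _ _ => prod_nonneg fun _ _ => heavyKernel_nonneg _ _ _

lemma lightWeight_nonneg (c : A → Bool) (a : A → Option (Fin D)) (y : A → Fin M × Bool) :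
    0 ≤ lightWeight c a y :=
  expect_nonneg fun _ _ => prod_nonneg fun _ _ => lightKernel_nonneg _ _ _ _

lemma jointLaw_nonneg {ε : ℝ} {w : Fin D → ℝ} (h0 : 0 ≤ ε) (h1 : ε ≤ 1) (hw : ∀ g, 0 ≤ w g)
    (c : A → Bool) (y : A → Fin M × Bool) (a : A → Option (Fin D)) : 0 ≤ jointLaw ε w c y a :=
  mul_nonneg (prod_nonneg fun _ _ => latentMass_nonneg h0 h1 hw _)
    (mul_nonneg (heavyWeight_nonneg _ _) (lightWeight_nonneg _ _ _))

lemma mixedLaw_blockMass [DecidableEq A] (ε : ℝ) (w : Fin D → ℝ) (c : A → Bool)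
    (y : A → Fin M × Bool) :
    mixedLaw (fun θ i => blockMass ε w θ (c i)) y = ∑ a, jointLaw ε w c y a := by
  simp only [mixedLaw, blockMass, Fintype.prod_sum, prod_mul_distrib, expect_sum_comm,
    ← mul_expect, expect_prod_type, ← expect_mul, jointLaw, heavyWeight, lightWeight]

/-- Light samples from different pairs have independent orientations, so negating the orientations
of the pairs on which `c` and `c'` disagree exchanges the two likelihoods. -/
lemma lightWeight_eq_of_injOn (c c' : A → Bool) {a : A → Option (Fin D)} {y : A → Fin M × Bool}
    (hinj : Set.InjOn (fun i => (y i).1) {i | a i = none}) :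
    lightWeight c a y = lightWeight c' a y := by
  classical
  let t : Fin M → Bool := fun v => ∃ i, a i = none ∧ (y i).1 = v ∧ (c i ^^ c' i)
  have ht : ∀ i, a i = none → t (y i).1 = (c i ^^ c' i) := by
    intro i hi
    rw [Bool.eq_iff_iff, decide_eq_true_iff]
    refine ⟨?_, fun hc => ⟨i, hi, rfl, hc⟩⟩
    rintro ⟨j, hj, hji, hc⟩
    rwa [hinj hj hi hji] at hc
  have hflip : Function.Involutive fun (z : Fin M → Bool) v => z v ^^ t v := fun z => by
    funext v
    simp only [Bool.xor_assoc, Bool.xor_self, Bool.xor_false]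
  refine Fintype.expect_equiv hflip.toPerm _ _ fun z => prod_congr rfl fun i _ => ?_
  cases hi : a i with
  | some g => rfl
  | none =>
    simp only [lightKernel, Function.Involutive.coe_toPerm, ht i hi]
    cases z (y i).1 <;> cases c i <;> cases c' i <;> rfl

lemma exists_unused_index (a : A → Option (Fin D)) (hD : Fintype.card A < D) :
    ∃ u : Fin D, (u : ℕ) ≤ Fintype.card A ∧ ∀ l, a l ≠ some u := by
  by_contra! hused
  choose l hl using fun u : Fin (Fintype.card A + 1) =>
    hused (Fin.castLE hD u) (Nat.lt_succ_iff.1 u.2)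
  have hinj : Function.Injective l := fun u v huv => by
    have hcast := (hl u).symm.trans (huv ▸ hl v)
    exact Fin.castLE_injective hD (Option.some_injective _ hcast)
  simpa using Fintype.card_le_of_injective l hinj

lemma expect_eq_card_mul_expect_ite {ι β : Type*} [Fintype ι] [DecidableEq ι] [Fintype β]
    [DecidableEq β] (u : ι) (v : β) (φ : (ι → β) → ℝ)
    (hφ : ∀ h b, φ (Function.update h u b) = φ h) :
    𝔼 h, φ h = Fintype.card β * 𝔼 h, if h u = v then φ h else 0 := by
  have hswap : ∀ b, (𝔼 h, if h u = b then φ h else 0) = 𝔼 h, if h u = v then φ h else 0 := by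
    intro b
    have hinv : Function.Involutive fun h : ι → β =>
        Function.update h u (Equiv.swap b v (h u)) := fun h => by simp
    refine Fintype.expect_equiv hinv.toPerm _ _ fun h => ?_
    simp only [Function.Involutive.coe_toPerm, Function.update_self, hφ, Equiv.swap_apply_eq_iff,
      Equiv.swap_apply_right]
  calc 𝔼 h, φ h = 𝔼 h, ∑ b, if h u = b then φ h else 0 := by
        simp only [sum_ite_eq, mem_univ, if_true]
    _ = _ := by rw [expect_sum_comm]; simp only [hswap, sum_const, card_univ, nsmul_eq_mul]

section UpdatePair

variable [DecidableEq A] {β : Type*}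

/-- The function `a` with both its values at `i` and `j` replaced by `b`. -/
def updatePair (a : A → β) (i j : A) (b : β) : A → β :=
  Function.update (Function.update a i b) j b

lemma prod_updatePair (g : A → β → ℝ) (a : A → β) {i j : A} (hij : i ≠ j) (b : β) :
    (∏ l, g l (updatePair a i j b l)) * (g i (a i) * g j (a j)) =
      (∏ l, g l (a l)) * (g i b * g j b) := by
  have hi : i ∈ univ.erase j := mem_erase.2 ⟨hij, mem_univ i⟩
  have hrest : ∏ l ∈ (univ.erase j).erase i, g l (updatePair a i j b l) =
      ∏ l ∈ (univ.erase j).erase i, g l (a l) := by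
    refine prod_congr rfl fun l hl => ?_
    obtain ⟨hli, hlj, -⟩ := by simpa only [mem_erase] using hl
    rw [updatePair, Function.update_of_ne hlj, Function.update_of_ne hli]
  rw [← mul_prod_erase _ _ (mem_univ j), ← mul_prod_erase _ _ hi, hrest,
    ← mul_prod_erase _ (fun l => g l (a l)) (mem_univ j),
    ← mul_prod_erase _ (fun l => g l (a l)) hi]
  simp only [updatePair, Function.update_self, Function.update_of_ne hij]
  ring

lemma sum_updatePair_le [Fintype β] [DecidableEq β] {t : (A → β) → ℝ} (ht : ∀ a, 0 ≤ t a)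
    (u : (A → β) → β) (i j : A) (b : β) :
    (∑ a, if a i = b ∧ a j = b then t (updatePair a i j (u a)) else 0) ≤ ∑ a, t a := by
  rw [← sum_filter, ← sum_image (f := t) (g := fun a => updatePair a i j (u a))]
  · exact sum_le_sum_of_subset_of_nonneg (subset_univ _) fun a _ _ => ht a
  · intro a ha a' ha' haa'
    simp only [coe_filter, mem_univ, true_and, Set.mem_ofPred_eq] at ha ha'
    funext l
    have hl := congrFun haa' l
    rcases eq_or_ne l i with rfl | hli
    · rw [ha.1, ha'.1]
    rcases eq_or_ne l j with rfl | hlj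
    · rw [ha.2, ha'.2]
    simpa only [updatePair, Function.update_of_ne hlj, Function.update_of_ne hli] using hl

variable {a : A → Option (Fin D)} {y : A → Fin M × Bool} {i j : A} {u : Fin D}

lemma heavyWeight_eq_mul_updatePair (hij : i ≠ j) (hi : a i = none) (hj : a j = none)
    (hy : (y i).1 = (y j).1) (hu : ∀ l, a l ≠ some u) :
    heavyWeight a y = 4 * M * heavyWeight (updatePair a i j (some u)) y := by
  have hindep : ∀ (h : Fin D → Fin M) b, ∏ l, heavyKernel (Function.update h u b) (a l) (y l) =
      ∏ l, heavyKernel h (a l) (y l) := by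
    intro h b
    refine prod_congr rfl fun l _ => ?_
    cases hl : a l with
    | none => rfl
    | some g =>
      have hg : g ≠ u := fun hg => hu l (by rw [hl, hg])
      simp only [heavyKernel, Function.update_of_ne hg]
  have hfix : ∀ h : Fin D → Fin M, (if h u = (y i).1 then ∏ l, heavyKernel h (a l) (y l) else 0) =
      4 * ∏ l, heavyKernel h (updatePair a i j (some u) l) (y l) := by
    intro h
    have hprod := prod_updatePair (fun l b => heavyKernel h b (y l)) a hij (some u)
    simp only [hi, hj, heavyKernel_none, heavyKernel_some, mul_one, ← hy] at hprod
    rw [hprod]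
    split_ifs <;> ring
  rw [heavyWeight, expect_eq_card_mul_expect_ite u (y i).1 _ hindep, Fintype.card_fin, heavyWeight]
  simp only [hfix, ← mul_expect]
  ring

lemma lightWeight_le_mul_updatePair (c c' : A → Bool) (y : A → Fin M × Bool) (hij : i ≠ j)
    (hi : a i = none) (hj : a j = none) :
    lightWeight c a y ≤
      8 ^ Fintype.card A / (M : ℝ) ^ 2 * lightWeight c' (updatePair a i j (some u)) y := by
  simp only [lightWeight, mul_expect]
  refine expect_le_expect fun z _ => ?_
  have hprod := prod_updatePair (fun l b => lightKernel z (c' l) b (y l)) a hij (some u)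
  simp only [hi, hj, lightKernel_some, mul_one] at hprod
  calc ∏ l, lightKernel z (c l) (a l) (y l)
      ≤ ∏ l, 8 * lightKernel z (c' l) (a l) (y l) :=
        prod_le_prod (fun l _ => lightKernel_nonneg _ _ _ _) fun l _ =>
          lightKernel_le_eight_mul _ _ _ _ _
    _ = 8 ^ Fintype.card A * ((∏ l, lightKernel z (c' l) (updatePair a i j (some u) l) (y l)) *
          (lightKernel (D := D) z (c' i) none (y i) *
            lightKernel (D := D) z (c' j) none (y j))) := by
        rw [hprod, prod_mul_distrib, prod_const, card_univ]
    _ ≤ 8 ^ Fintype.card A * ((∏ l, lightKernel z (c' l) (updatePair a i j (some u) l) (y l)) *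
          (1 / M * (1 / M))) := by
        have hnonneg := prod_nonneg fun l (_ : l ∈ univ) =>
          lightKernel_nonneg z (c' l) (y l) (updatePair a i j (some u) l)
        gcongr
        · exact lightKernel_nonneg _ _ _ _
        · exact lightKernel_none_le _ _ _
        · exact lightKernel_none_le _ _ _
    _ = _ := by ring

lemma sq_mul_prod_latentMass_le {ε r : ℝ} {w : Fin D → ℝ} (h0 : 0 ≤ ε) (h1 : ε ≤ 1)
    (hw : ∀ g, 0 ≤ w g) (hr : 0 ≤ r) (hru : r ≤ (1 - ε) * w u) (hij : i ≠ j) (hi : a i = none)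
    (hj : a j = none) :
    r ^ 2 * ∏ l, latentMass ε w (a l) ≤
      ε ^ 2 * ∏ l, latentMass ε w (updatePair a i j (some u) l) := by
  have hprod := prod_updatePair (fun _ => latentMass ε w) a hij (some u)
  simp only [hi, hj, latentMass_none, latentMass_some, ← sq] at hprod
  calc r ^ 2 * ∏ l, latentMass ε w (a l)
      ≤ ((1 - ε) * w u) ^ 2 * ∏ l, latentMass ε w (a l) := by
        have hnonneg := prod_nonneg fun l (_ : l ∈ univ) => latentMass_nonneg h0 h1 hw (a l)
        gcongr
    _ = ε ^ 2 * ∏ l, latentMass ε w (updatePair a i j (some u) l) := by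
        rw [mul_comm, ← hprod, mul_comm]

end UpdatePair

end LatentDecomposition

section Collision

variable {D M : ℕ} {A : Type*} [Fintype A] {ε : ℝ} {w : Fin D → ℝ}

section UpdatePair

variable [DecidableEq A]

lemma prod_latentMass_le_mul_updatePair (h0 : 0 ≤ ε) (h1 : ε ≤ 2 / 3)
    (hw : ∀ g : Fin D, (1 / 2) ^ (g + 1 : ℕ) ≤ w g) {a : A → Option (Fin D)} {i j : A} {u : Fin D}
    (hij : i ≠ j) (hi : a i = none) (hj : a j = none) {k : ℕ} (huk : (u : ℕ) ≤ k) :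
    ∏ l, latentMass ε w (a l) ≤
      36 * 4 ^ k * ε ^ 2 * ∏ l, latentMass ε w (updatePair a i j (some u) l) := by
  have hru : (1 / 2) ^ k / 6 ≤ (1 - ε) * w u := by
    have hwu : (1 / 2) ^ (k + 1) ≤ w u :=
      (pow_le_pow_of_le_one (by norm_num) (by norm_num) (by omega)).trans (hw u)
    calc (1 / 2 : ℝ) ^ k / 6 = 1 / 3 * (1 / 2) ^ (k + 1) := by ring
      _ ≤ (1 - ε) * w u := mul_le_mul (by linarith) hwu (by positivity) (by linarith)
  have hsquare : 36 * 4 ^ k * ((1 / 2 : ℝ) ^ k / 6) ^ 2 = 1 := by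
    calc 36 * 4 ^ k * ((1 / 2 : ℝ) ^ k / 6) ^ 2 = (4 * (1 / 2) ^ 2) ^ k := by
          rw [mul_pow, ← pow_mul, mul_comm 2 k, pow_mul]
          ring
      _ = 1 := by norm_num
  calc ∏ l, latentMass ε w (a l)
      = 36 * 4 ^ k * (((1 / 2) ^ k / 6) ^ 2 * ∏ l, latentMass ε w (a l)) := by
        rw [← mul_assoc, hsquare, one_mul]
    _ ≤ 36 * 4 ^ k * (ε ^ 2 * ∏ l, latentMass ε w (updatePair a i j (some u) l)) := by
        gcongr 36 * 4 ^ k * ?_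
        exact sq_mul_prod_latentMass_le h0 (by linarith)
          (fun g => le_trans (by positivity) (hw g)) (by positivity) hru hij hi hj
    _ = _ := by ring

/-- A collision of two light samples can be re-explained as a repetition of the heavy pair `u`,
which no other sample hits, and this explanation is likelier by a factor of order `M / ε²`. -/
lemma jointLaw_le_mul_updatePair (h0 : 0 ≤ ε) (h1 : ε ≤ 2 / 3)
    (hw : ∀ g : Fin D, (1 / 2) ^ (g + 1 : ℕ) ≤ w g) (c c' : A → Bool) {a : A → Option (Fin D)}
    {y : A → Fin M × Bool} {i j : A} {u : Fin D} (hij : i ≠ j) (hi : a i = none) (hj : a j = none)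
    (hy : (y i).1 = (y j).1) (huk : (u : ℕ) ≤ Fintype.card A)
    (hu : ∀ l, a l ≠ some u) :
    jointLaw ε w c y a ≤ 144 * 32 ^ Fintype.card A * (ε ^ 2 / M) *
      jointLaw ε w c' y (updatePair a i j (some u)) := by
  set k := Fintype.card A
  have hlatent := prod_latentMass_le_mul_updatePair h0 h1 hw hij hi hj huk
  have hlight := lightWeight_le_mul_updatePair c c' y (u := u) hij hi hj
  set a' := updatePair a i j (some u)
  calc jointLaw ε w c y a
      = (∏ l, latentMass ε w (a l)) * (4 * M * heavyWeight a' y * lightWeight c a y) := by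
        rw [jointLaw, heavyWeight_eq_mul_updatePair hij hi hj hy hu]
    _ ≤ (36 * 4 ^ k * ε ^ 2 * ∏ l, latentMass ε w (a' l)) *
          (4 * M * heavyWeight a' y * (8 ^ k / (M : ℝ) ^ 2 * lightWeight c' a' y)) := by
        have hheavy0 := heavyWeight_nonneg a' y
        have hlight0 := lightWeight_nonneg c a y
        have hlatent0 := prod_nonneg fun l (_ : l ∈ univ) => latentMass_nonneg h0 (by linarith)
          (fun g => le_trans (by positivity) (hw g)) (a' l)
        gcongr
    _ = 144 * (4 * 8) ^ k * (ε ^ 2 * (M / (M * M))) * jointLaw ε w c' y a' := by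
        rw [jointLaw, mul_pow]
        ring
    _ = 144 * 32 ^ k * (ε ^ 2 / M) * jointLaw ε w c' y a' := by
        rw [div_self_mul_self', ← div_eq_mul_inv]
        norm_num

lemma abs_jointLaw_sub_le (h0 : 0 ≤ ε) (h1 : ε ≤ 2 / 3)
    (hw : ∀ g : Fin D, (1 / 2) ^ (g + 1 : ℕ) ≤ w g) (c c' : A → Bool)
    {a : A → Option (Fin D)} (y : A → Fin M × Bool) {u : Fin D} (huk : (u : ℕ) ≤ Fintype.card A)
    (hu : ∀ l, a l ≠ some u) :
    |jointLaw ε w c y a - jointLaw ε w c' y a| ≤ ∑ ij ∈ univ.offDiag,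
      if a ij.1 = none ∧ a ij.2 = none then 144 * 32 ^ Fintype.card A * (ε ^ 2 / M) *
        jointLaw ε w c' y (updatePair a ij.1 ij.2 (some u)) else 0 := by
  have hnonneg := jointLaw_nonneg h0 (by linarith) (fun g => le_trans (by positivity) (hw g))
    (A := A) (M := M)
  have hterm : ∀ ij : A × A, 0 ≤ if a ij.1 = none ∧ a ij.2 = none then
      144 * 32 ^ Fintype.card A * (ε ^ 2 / M) *
        jointLaw ε w c' y (updatePair a ij.1 ij.2 (some u)) else 0 := fun ij => by
    have := hnonneg c' y (updatePair a ij.1 ij.2 (some u))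
    positivity
  by_cases hinj : Set.InjOn (fun i => (y i).1) {i | a i = none}
  · rw [jointLaw, jointLaw, lightWeight_eq_of_injOn c c' hinj, sub_self, abs_zero]
    exact sum_nonneg fun ij _ => hterm ij
  · simp only [Set.InjOn, not_forall] at hinj
    obtain ⟨i, hi, j, hj, hy, hij⟩ := hinj
    have hmem : (i, j) ∈ univ.offDiag := by simpa using hij
    refine le_trans ?_ (single_le_sum (fun ij _ => hterm ij) hmem)
    rw [if_pos ⟨hi, hj⟩]
    exact abs_sub_le_of_nonneg_of_le (hnonneg c y a)
      (jointLaw_le_mul_updatePair h0 h1 hw c c' hij hi hj hy huk hu) (hnonneg c' y a)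
      (jointLaw_le_mul_updatePair h0 h1 hw c' c' hij hi hj hy huk hu)

end UpdatePair

lemma abs_mixedLaw_blockMass_sub_le (h0 : 0 ≤ ε) (h1 : ε ≤ 2 / 3)
    (hw : ∀ g : Fin D, (1 / 2) ^ (g + 1 : ℕ) ≤ w g) (hD : Fintype.card A < D) (c c' : A → Bool)
    (y : A → Fin M × Bool) :
    |mixedLaw (fun θ i => blockMass ε w θ (c i)) y -
        mixedLaw (fun θ i => blockMass ε w θ (c' i)) y| ≤
      144 * 32 ^ Fintype.card A * (ε ^ 2 / M) * #(univ : Finset A).offDiag *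
        mixedLaw (fun θ i => blockMass ε w θ (c' i)) y := by
  classical
  have hnonneg := jointLaw_nonneg h0 (by linarith) (fun g => le_trans (by positivity) (hw g)) c' y
  choose u huk hu using fun a : A → Option (Fin D) => exists_unused_index a hD
  set C := 144 * 32 ^ Fintype.card A * (ε ^ 2 / M)
  calc |mixedLaw (fun θ i => blockMass ε w θ (c i)) y -
          mixedLaw (fun θ i => blockMass ε w θ (c' i)) y|
      = |∑ a, (jointLaw ε w c y a - jointLaw ε w c' y a)| := by
        rw [mixedLaw_blockMass, mixedLaw_blockMass, sum_sub_distrib]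
    _ ≤ ∑ a, ∑ ij ∈ univ.offDiag, if a ij.1 = none ∧ a ij.2 = none then
          C * jointLaw ε w c' y (updatePair a ij.1 ij.2 (some (u a))) else 0 :=
        (abs_sum_le_sum_abs _ _).trans <| sum_le_sum fun a _ =>
          abs_jointLaw_sub_le h0 h1 hw c c' y (huk a) (hu a)
    _ = ∑ ij ∈ univ.offDiag, C * ∑ a, if a ij.1 = none ∧ a ij.2 = none then
          jointLaw ε w c' y (updatePair a ij.1 ij.2 (some (u a))) else 0 := by
        rw [sum_comm]
        simp only [mul_sum, mul_ite, mul_zero]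
    _ ≤ ∑ _ij ∈ (univ : Finset A).offDiag, C * ∑ a, jointLaw ε w c' y a := by
        refine sum_le_sum fun ij _ => mul_le_mul_of_nonneg_left ?_ (by positivity)
        exact sum_updatePair_le hnonneg _ _ _ _
    _ = _ := by
        rw [sum_const, nsmul_eq_mul, mixedLaw_blockMass]
        ring

/-- Such weights serve all sample sizes `k < D` at once: some index `u ≤ k` is unused by the
samples, and the loss `2 ^ (k + 1)` is only exponential in the number of samples in the block. -/
lemma exists_sum_eq_one_forall_half_pow_le (hD : 0 < D) :
    ∃ w : Fin D → ℝ, ∑ g, w g = 1 ∧ ∀ g : Fin D, (1 / 2) ^ (g + 1 : ℕ) ≤ w g := by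
  have hsum : ∑ g : Fin D, (1 / 2 : ℝ) ^ (g + 1 : ℕ) = 1 - (1 / 2) ^ D := by
    rw [Fin.sum_univ_eq_sum_range fun g => (1 / 2 : ℝ) ^ (g + 1)]
    simp only [pow_succ, ← sum_mul]
    rw [geom_sum_eq (by norm_num)]
    ring
  have hlt : (1 / 2 : ℝ) ^ D < 1 := pow_lt_one₀ (by norm_num) (by norm_num) hD.ne'
  refine ⟨fun g => (1 / 2) ^ (g + 1 : ℕ) / (1 - (1 / 2) ^ D), ?_, fun g => ?_⟩
  · rw [← sum_div, hsum, div_self (by linarith)]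
  · exact le_div_self (by positivity) (by linarith) (sub_le_self _ (by positivity))

end Collision

section BlockAverage

variable {Θ ι κ W : Type*} [Fintype κ]

/-- The mass function on a union of equally likely blocks, the block `j` having mass function
`f (θ j)`. -/
noncomputable def blockAverage (f : Θ → W → ℝ) (θ : κ → Θ) (x : κ × W) : ℝ :=
  f (θ x.1) x.2 / Fintype.card κ

lemma blockAverage_nonneg {f : Θ → W → ℝ} (hf : ∀ θ y, 0 ≤ f θ y) (θ : κ → Θ) (x : κ × W) :
    0 ≤ blockAverage f θ x :=
  div_nonneg (hf _ _) (Nat.cast_nonneg _)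

lemma sum_blockAverage_mul [Fintype W] (f : Θ → W → ℝ) (θ : κ → Θ) (φ : κ × W → ℝ) :
    ∑ x, blockAverage f θ x * φ x = 𝔼 j, ∑ y, f (θ j) y * φ (j, y) := by
  simp only [blockAverage, Fintype.sum_prod_type, Fintype.expect_eq_sum_div_card, sum_div,
    div_mul_eq_mul_div]

variable [Fintype Θ] [Fintype ι] [DecidableEq κ]

/-- The law, averaged over the parameter, of the samples that `J` assigns to the block `j`, the
sample `i` having mass function `f i θ`. -/
noncomputable def fiberLaw (f : ι → Θ → W → ℝ) (J : ι → κ) (j : κ) :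
    ({i // J i = j} → W) → ℝ :=
  mixedLaw fun θ i => f i θ

lemma mixedLaw_blockAverage (f : ι → Θ → W → ℝ) (J : ι → κ) (Y : ι → W) :
    mixedLaw (fun (θ : κ → Θ) i => blockAverage (f i) θ) (fun i => (J i, Y i)) =
      (∏ j, fiberLaw f J j fun i => Y i) / Fintype.card κ ^ Fintype.card ι := by
  have hfiber : ∀ θ : κ → Θ, ∏ i, f i (θ (J i)) (Y i) =
      ∏ j, ∏ i : {i // J i = j}, f i (θ j) (Y i) := fun θ => by
    rw [← Fintype.prod_fiberwise J]
    exact prod_congr rfl fun j _ => prod_congr rfl fun i _ => by rw [i.2]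
  simp only [fiberLaw, mixedLaw, blockAverage, prod_div_distrib, prod_const, card_univ,
    ← expect_div, hfiber]
  rw [expect_pi_prod fun j θ => ∏ i : {i // J i = j}, f i θ (Y i)]

variable [DecidableEq ι] [Fintype W]

lemma sum_restrict_fibers (J : ι → κ) (F : (∀ j, {i // J i = j} → W) → ℝ) :
    ∑ Y : ι → W, F (fun _ i => Y i) = ∑ Z, F Z :=
  (((Equiv.sigmaFiberEquiv J).arrowCongr (Equiv.refl W)).symm.trans
    (Equiv.piCurry fun j (_ : {i // J i = j}) => W)).sum_comp F

lemma sum_abs_mixedLaw_blockAverage_sub [Nonempty κ] (f f' : ι → Θ → W → ℝ) :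
    ∑ X : ι → κ × W, |mixedLaw (fun θ i => blockAverage (f i) θ) X -
      mixedLaw (fun θ i => blockAverage (f' i) θ) X| =
        𝔼 J : ι → κ, ∑ Z : ∀ j, {i // J i = j} → W,
          |∏ j, fiberLaw f J j (Z j) - ∏ j, fiberLaw f' J j (Z j)| := by
  have hcard : (0 : ℝ) < Fintype.card κ ^ Fintype.card ι := by positivity
  simp only [sum_eq_card_pow_mul_expect, mixedLaw_blockAverage, ← sub_div, abs_div,
    abs_of_pos hcard, ← sum_div, ← expect_div]
  rw [mul_div_cancel₀ _ hcard.ne']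
  exact expect_congr rfl fun J _ => sum_restrict_fibers J fun Z =>
    |∏ j, fiberLaw f J j (Z j) - ∏ j, fiberLaw f' J j (Z j)|

lemma sq_sum_abs_mixedLaw_blockAverage_sub_le [Nonempty Θ] [Nonempty κ] {f f' : ι → Θ → W → ℝ}
    (hf0 : ∀ i θ y, 0 ≤ f i θ y) (hf0' : ∀ i θ y, 0 ≤ f' i θ y) (hf1 : ∀ i θ, ∑ y, f i θ y = 1)
    (hf1' : ∀ i θ, ∑ y, f' i θ y = 1) {δ : (ι → κ) → κ → ℝ}
    (hδ : ∀ J j Z, |fiberLaw f J j Z - fiberLaw f' J j Z| ≤ δ J j * fiberLaw f' J j Z) :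
    (∑ X : ι → κ × W, |mixedLaw (fun θ i => blockAverage (f i) θ) X -
      mixedLaw (fun θ i => blockAverage (f' i) θ) X|) ^ 2 ≤ 8 * 𝔼 J, ∑ j, δ J j ^ 2 := by
  rw [sum_abs_mixedLaw_blockAverage_sub, mul_expect]
  refine (sq_expect_le_expect_sq _).trans (expect_le_expect fun J _ => ?_)
  exact sq_sum_abs_prod_sub_prod_le _ _ (δ J) (fun j => mixedLaw_nonneg fun θ i => hf0 i θ)
    (fun j => mixedLaw_nonneg fun θ i => hf0' i θ) (fun j => sum_mixedLaw fun θ i => hf1 i θ)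
    (fun j => sum_mixedLaw fun θ i => hf1' i θ) (hδ J)

end BlockAverage

section Occupancy

variable {ι κ : Type*} [Fintype ι] [DecidableEq ι] [DecidableEq κ]

lemma card_offDiag_fiber_mul_pow (J : ι → κ) (j : κ) (B : ℝ) :
    #(univ : Finset {i // J i = j}).offDiag * B ^ Fintype.card {i // J i = j} =
      ∑ p ∈ (univ : Finset ι).offDiag, ∏ l, (if J l = j then B else 1) *
        (if l ∈ ({p.1, p.2} : Finset ι) then if J l = j then 1 else 0 else 1) := by
  have hpow : ∏ l, (if J l = j then B else 1) = B ^ Fintype.card {i // J i = j} := by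
    rw [prod_ite, prod_const, prod_const_one, mul_one, Fintype.card_subtype]
  have hpair : ∀ p : ι × ι, (∏ l, if l ∈ ({p.1, p.2} : Finset ι) then
      if J l = j then (1 : ℝ) else 0 else 1) = if J p.1 = j ∧ J p.2 = j then 1 else 0 := fun p => by
    rw [prod_ite_mem, univ_inter, prod_boole]
    simp
  have hcard : #(univ : Finset {i // J i = j}).offDiag =
      #{p ∈ (univ : Finset ι).offDiag | J p.1 = j ∧ J p.2 = j} := by
    rw [offDiag_card, card_univ, Fintype.card_subtype, ← offDiag_card]
    congr 1
    ext p
    simp only [mem_offDiag, mem_filter, mem_univ, true_and]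
    tauto
  simp only [prod_mul_distrib, hpow, hpair, ← mul_sum, sum_boole, hcard]
  ring

variable [Fintype κ] [Nonempty κ]

lemma expect_pair_factor_le (j : κ) {B : ℝ} (hB : 0 ≤ B) (p : Prop) [Decidable p] :
    𝔼 v : κ, (if v = j then B else 1) * (if p then if v = j then 1 else 0 else 1) ≤
      (if p then B / Fintype.card κ else 1) * Real.exp (B / Fintype.card κ) := by
  by_cases hp : p
  · have hval : 𝔼 v : κ, (if v = j then B else 1) * (if v = j then 1 else 0) =
        B / Fintype.card κ := by
      rw [Fintype.expect_eq_sum_div_card]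
      simp
    simp only [hp, if_true, hval]
    exact le_mul_of_one_le_right (by positivity) (Real.one_le_exp (by positivity))
  · simp only [hp, if_false, mul_one, one_mul]
    calc 𝔼 v : κ, (if v = j then B else 1) ≤ 𝔼 v : κ, ((if v = j then B else 0) + 1) :=
          expect_le_expect fun v _ => by split_ifs <;> simp
      _ = B / Fintype.card κ + 1 := by
          rw [expect_add_distrib, Fintype.expect_const, Fintype.expect_eq_sum_div_card]
          simp
      _ ≤ _ := Real.add_one_le_exp _

lemma expect_card_offDiag_fiber_mul_pow_le (j : κ) {B : ℝ} (hB : 0 ≤ B) :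
    𝔼 J : ι → κ, #(univ : Finset {i // J i = j}).offDiag * B ^ Fintype.card {i // J i = j} ≤
      (Fintype.card ι * (B / Fintype.card κ)) ^ 2 *
        Real.exp (Fintype.card ι * (B / Fintype.card κ)) := by
  set b := B / Fintype.card κ
  have hterm : ∀ p ∈ (univ : Finset ι).offDiag, 𝔼 J : ι → κ, ∏ l, (if J l = j then B else 1) *
      (if l ∈ ({p.1, p.2} : Finset ι) then if J l = j then 1 else 0 else 1) ≤
        b ^ 2 * Real.exp (Fintype.card ι * b) := by
    intro p hp
    rw [expect_pi_prod fun l v => (if v = j then B else 1) *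
      (if l ∈ ({p.1, p.2} : Finset ι) then if v = j then 1 else 0 else 1)]
    calc _ ≤ ∏ l, (if l ∈ ({p.1, p.2} : Finset ι) then b else 1) * Real.exp b :=
          prod_le_prod (fun l _ => expect_nonneg fun v _ => by positivity)
            fun l _ => expect_pair_factor_le j hB _
      _ = b ^ 2 * Real.exp (Fintype.card ι * b) := by
          rw [prod_mul_distrib, prod_ite_mem, univ_inter, prod_const, prod_const,
            card_pair (mem_offDiag.1 hp).2.2, card_univ, Real.exp_nat_mul]
  calc 𝔼 J : ι → κ, #(univ : Finset {i // J i = j}).offDiag * B ^ Fintype.card {i // J i = j}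
      ≤ ∑ _p ∈ (univ : Finset ι).offDiag, b ^ 2 * Real.exp (Fintype.card ι * b) := by
        simp only [card_offDiag_fiber_mul_pow, expect_sum_comm]
        exact sum_le_sum hterm
    _ = #(univ : Finset ι).offDiag * (b ^ 2 * Real.exp (Fintype.card ι * b)) := by
        rw [sum_const, nsmul_eq_mul]
    _ ≤ (Fintype.card ι : ℝ) ^ 2 * (b ^ 2 * Real.exp (Fintype.card ι * b)) := by
        gcongr
        rw [offDiag_card, card_univ, sq]
        exact_mod_cast Nat.sub_le _ _
    _ = _ := by ring

end Occupancy

section Closeness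

lemma sq_const_mul_card_offDiag_le {A : Type*} [Fintype A] (x : ℝ) :
    (144 * 32 ^ Fintype.card A * x * #(univ : Finset A).offDiag) ^ 2 ≤
      144 ^ 2 * x ^ 2 * (#(univ : Finset A).offDiag * 4096 ^ Fintype.card A) := by
  set k := Fintype.card A
  have hoff : (#(univ : Finset A).offDiag : ℝ) ≤ 4 ^ k := by
    have hk : k * k ≤ 2 ^ k * 2 ^ k := Nat.mul_self_le_mul_self Nat.lt_two_pow_self.le
    rw [← mul_pow] at hk
    rw [offDiag_card, card_univ]
    exact_mod_cast (Nat.sub_le _ _).trans hk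
  calc (144 * 32 ^ k * x * #(univ : Finset A).offDiag) ^ 2
      = 144 ^ 2 * x ^ 2 * (#(univ : Finset A).offDiag * ((32 * 32) ^ k *
          #(univ : Finset A).offDiag)) := by
        rw [mul_pow 32]
        ring
    _ ≤ 144 ^ 2 * x ^ 2 * (#(univ : Finset A).offDiag * ((32 * 32) ^ k * 4 ^ k)) := by gcongr
    _ = _ := by
        rw [← mul_pow (32 * 32 : ℝ), show (32 * 32 * 4 : ℝ) = 4096 by norm_num]

variable {D M m : ℕ}

/-- The sign that records whether the label of a sample disagrees with the orientation of its pair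
in `θ`, used as a test function: its mean separates the two values of `σ` in `blockMass`. -/
def blockSign (θ : Fin m → (Fin D → Fin M) × (Fin M → Bool)) (x : Fin m × (Fin M × Bool)) : ℝ :=
  boolSign (x.2.2 ^^ (θ x.1).2 x.2.1)

lemma sum_blockSign (θ : Fin m → (Fin D → Fin M) × (Fin M → Bool)) : ∑ x, blockSign θ x = 0 := by
  have hpair : ∀ b, ∑ b', boolSign (b' ^^ b) = 0 := fun b => by
    cases b <;> simp [boolSign]
  simp only [blockSign, Fintype.sum_prod_type, hpair, sum_const_zero]

variable [NeZero M] [NeZero m] {ε : ℝ} {w : Fin D → ℝ}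

lemma sq_sum_abs_mixedLaw_blocks_sub_le {ι : Type*} [Fintype ι] [DecidableEq ι] (h0 : 0 ≤ ε)
    (h1 : ε ≤ 2 / 3) (hw1 : ∑ g, w g = 1) (hw : ∀ g : Fin D, (1 / 2) ^ (g + 1 : ℕ) ≤ w g)
    (hD : Fintype.card ι < D) (c c' : ι → Bool) :
    (∑ X : ι → Fin m × (Fin M × Bool),
      |mixedLaw (fun θ i => blockAverage (fun θ => blockMass ε w θ (c i)) θ) X -
        mixedLaw (fun θ i => blockAverage (fun θ => blockMass ε w θ (c' i)) θ) X|) ^ 2 ≤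
      8 * (m * (144 ^ 2 * (ε ^ 2 / M) ^ 2 * ((Fintype.card ι * (4096 / m)) ^ 2 *
        Real.exp (Fintype.card ι * (4096 / m))))) := by
  have hw0 : ∀ g, 0 ≤ w g := fun g => le_trans (by positivity) (hw g)
  have hnonneg := fun (c : ι → Bool) i (θ : (Fin D → Fin M) × (Fin M → Bool)) =>
    blockMass_nonneg h0 (by linarith) hw0 θ (c i)
  have hsum := fun (c : ι → Bool) i (θ : (Fin D → Fin M) × (Fin M → Bool)) =>
    sum_blockMass ε hw1 θ (c i)
  have hcard : ∀ (J : ι → Fin m) j, Fintype.card {i // J i = j} < D := fun J j =>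
    (Fintype.card_subtype_le _).trans_lt hD
  refine (sq_sum_abs_mixedLaw_blockAverage_sub_le (hnonneg c) (hnonneg c') (hsum c) (hsum c')
    fun J j => abs_mixedLaw_blockMass_sub_le h0 h1 hw (hcard J j) _ _).trans ?_
  rw [expect_sum_comm]
  refine mul_le_mul_of_nonneg_left ?_ (by norm_num)
  calc ∑ j : Fin m, 𝔼 J : ι → Fin m, (144 * 32 ^ Fintype.card {i // J i = j} * (ε ^ 2 / M) *
        #(univ : Finset {i // J i = j}).offDiag) ^ 2
      ≤ ∑ j : Fin m, 𝔼 J : ι → Fin m, 144 ^ 2 * (ε ^ 2 / M) ^ 2 *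
          (#(univ : Finset {i // J i = j}).offDiag * 4096 ^ Fintype.card {i // J i = j}) :=
        sum_le_sum fun j _ => expect_le_expect fun J _ => sq_const_mul_card_offDiag_le _
    _ ≤ ∑ _j : Fin m, 144 ^ 2 * (ε ^ 2 / M) ^ 2 * ((Fintype.card ι * (4096 / m)) ^ 2 *
          Real.exp (Fintype.card ι * (4096 / m))) := by
        simp only [← mul_expect]
        gcongr with j
        simpa only [Fintype.card_fin] using
          expect_card_offDiag_fiber_mul_pow_le (ι := ι) j (by norm_num : (0 : ℝ) ≤ 4096)
    _ = _ := by rw [sum_const, card_univ, Fintype.card_fin, nsmul_eq_mul]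

lemma sum_blockAverage_mul_blockSign (ε : ℝ) (w : Fin D → ℝ)
    (θ : Fin m → (Fin D → Fin M) × (Fin M → Bool)) (σ : Bool) :
    ∑ x, blockAverage (fun θ => blockMass ε w θ σ) θ x * blockSign θ x =
      3 / 4 * ε * boolSign σ := by
  simp only [sum_blockAverage_mul, blockSign, sum_blockMass_mul_boolSign, Fintype.expect_const]

lemma sum_blockAverage_blockMass (ε : ℝ) (hw : ∑ g, w g = 1)
    (θ : Fin m → (Fin D → Fin M) × (Fin M → Bool)) (σ : Bool) :
    ∑ x, blockAverage (fun θ => blockMass ε w θ σ) θ x = 1 := by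
  simpa only [mul_one, sum_blockMass ε hw, Fintype.expect_const] using
    sum_blockAverage_mul (fun θ => blockMass ε w θ σ) θ fun _ => 1

lemma isFar_map_blockAverage {n : ℕ} [NeZero n] (f : Fin m × (Fin M × Bool) ↪ Fin n)
    (h1 : ε ≤ 2 / 3) (hn : 4 * (m * M) ≤ n) (θ : Fin m → (Fin D → Fin M) × (Fin M → Bool))
    {p q : PMF (Fin m × (Fin M × Bool))}
    (hp : ∀ x, (p x).toReal = blockAverage (fun θ => blockMass ε w θ true) θ x)
    (hq : ∀ x, (q x).toReal = blockAverage (fun θ => blockMass ε w θ false) θ x) :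
    IsFar (3 / 2 * ε) (p.map f) (mixtures (q.map f) (PMF.uniformOfFintype (Fin n))) := by
  rw [show 3 / 2 * ε = 3 / 4 * ε - -(3 / 4 * ε) by ring]
  refine isFar_map_mixtures_uniform f (φ := blockSign θ) (fun x => (abs_boolSign _).le) ?_ ?_ ?_
  · simp only [hp, sum_blockAverage_mul_blockSign, boolSign, if_true, mul_one, le_refl]
  · simp only [hq, sum_blockAverage_mul_blockSign, boolSign, Bool.false_eq_true, if_false, mul_neg,
      mul_one, le_refl]
  · have hn' : (4 * (m * M) : ℝ) ≤ n := by exact_mod_cast hn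
    rw [sum_add_distrib, sum_blockSign]
    simp only [sum_const, card_univ, Fintype.card_prod, Fintype.card_fin, Fintype.card_bool,
      nsmul_eq_mul, mul_one, Nat.cast_mul, Nat.cast_ofNat]
    have hhalf : 1 / 2 * n ≤ (1 + -(3 / 4 * ε)) * n :=
      mul_le_mul_of_nonneg_right (by linarith) (Nat.cast_nonneg n)
    linarith

lemma IsClosenessTester.one_third_sq_le_of_blocks {n s : ℕ} [NeZero n] (hn : 4 * (m * M) ≤ n)
    (h0 : 0 ≤ ε) (h1 : ε ≤ 2 / 3) {T : Algorithm n}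
    (hT : IsClosenessTester (PMF.uniformOfFintype (Fin n)) (3 / 2 * ε) T)
    (hs : T.DrawsAtMost s) :
    (1 / 3 : ℝ) ^ 2 ≤ 8 * (m * (144 ^ 2 * (ε ^ 2 / M) ^ 2 * ((2 * s * (4096 / m)) ^ 2 *
      Real.exp (2 * s * (4096 / m))))) := by
  obtain ⟨w, hw1, hw⟩ := exists_sum_eq_one_forall_half_pow_le (2 * s).succ_pos
  obtain ⟨f⟩ : Nonempty (Fin m × (Fin M × Bool) ↪ Fin n) :=
    Function.Embedding.nonempty_of_card_le <| by
      simp only [Fintype.card_prod, Fintype.card_fin, Fintype.card_bool]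
      lia
  choose p hp using fun σ (θ : Fin m → _ × (Fin M → Bool)) => exists_pmf_toReal_eq
    (blockAverage_nonneg (fun θ => blockMass_nonneg h0 (by linarith)
      (fun g => le_trans (by positivity) (hw g)) θ σ) θ) (sum_blockAverage_blockMass ε hw1 θ σ)
  have hgap := hT.one_third_le_sum_abs_mixedLaw_sub hs f (p₀ := p false) (q₀ := p false)
    (p₁ := p true) (q₁ := p false) (fun _ => self_mem_mixtures _ _)
    fun θ => isFar_map_blockAverage f h1 hn θ (hp true θ) (hp false θ)
  have hnull : (fun θ => sampleMass s (p false θ) (p false θ)) =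
      fun θ _ => blockAverage (fun θ => blockMass ε w θ false) θ := by
    ext θ (i | i) x <;> exact hp false θ x
  have halt : (fun θ => sampleMass s (p true θ) (p false θ)) =
      fun θ i => blockAverage (fun θ => blockMass ε w θ (Sum.isLeft i)) θ := by
    ext θ (i | i) x
    exacts [hp true θ x, hp false θ x]
  rw [hnull, halt] at hgap
  have hcard : Fintype.card (Fin s ⊕ Fin s) = 2 * s := by
    rw [Fintype.card_sum, Fintype.card_fin, two_mul]
  have hbound := sq_sum_abs_mixedLaw_blocks_sub_le (M := M) (m := m) h0 h1 hw1 hw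
    (hcard.trans_lt (2 * s).lt_succ_self) (fun _ => false) Sum.isLeft
  rw [hcard, Nat.cast_mul, Nat.cast_ofNat] at hbound
  exact (pow_le_pow_left₀ (by norm_num) hgap 2).trans hbound

lemma IsClosenessTester.sq_card_le_of_drawsAtMost_of_eight_mul_le {n s : ℕ} [NeZero n] (hs0 : 0 < s)
    (hsn : 8 * s ≤ n) {ε : ℝ} (h0 : 0 ≤ ε) (h1 : ε ≤ 1) {T : Algorithm n}
    (hT : IsClosenessTester (PMF.uniformOfFintype (Fin n)) ε T) (hs : T.DrawsAtMost s) :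
    (n : ℝ) ^ 2 ≤ 10 ^ 16 * Real.exp 4096 * (s ^ 3 * ε ^ 4) := by
  obtain ⟨M, hM⟩ : ∃ M, M = n / (4 * (2 * s)) := ⟨_, rfl⟩
  have hM0 : 0 < M := hM ▸ Nat.div_pos (by lia) (by lia)
  have : NeZero (2 * s) := ⟨by lia⟩
  have : NeZero M := ⟨hM0.ne'⟩
  have hMn : 4 * (2 * s * M) ≤ n := by
    rw [← mul_assoc, hM]
    exact Nat.mul_div_le n (4 * (2 * s))
  have hnM : (n : ℝ) ≤ 16 * s * M := by
    have hlt : n < 4 * (2 * s) * (M + 1) := hM ▸ Nat.lt_mul_div_succ n (by lia)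
    have hle : s * 1 ≤ s * M := Nat.mul_le_mul_left s hM0
    exact_mod_cast (show n ≤ 16 * s * M by lia)
  have hgap := IsClosenessTester.one_third_sq_le_of_blocks (ε := 2 / 3 * ε) hMn
    (by linarith) (by linarith) (by rwa [show 3 / 2 * (2 / 3 * ε) = ε by ring]) hs
  have hs0' : (0 : ℝ) < s := by exact_mod_cast hs0
  have hM0' : (0 : ℝ) < M := by exact_mod_cast hM0
  rw [Nat.cast_mul, Nat.cast_ofNat, mul_div_cancel₀ (4096 : ℝ) (by positivity)] at hgap
  have hM2 : (M : ℝ) ^ 2 ≤ 10 ^ 13 * Real.exp 4096 * (s * ε ^ 4) := by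
    have hmul := mul_le_mul_of_nonneg_right hgap (sq_nonneg (M : ℝ))
    have hcancel : ((2 / 3 * ε) ^ 2 / M) ^ 2 * (M : ℝ) ^ 2 = 16 / 81 * ε ^ 4 := by
      rw [← mul_pow, div_mul_cancel₀ _ hM0'.ne']
      ring
    have hpos : 0 ≤ Real.exp 4096 * (s * ε ^ 4) := by positivity
    linear_combination 9 * hmul + 9 * (16 * 144 ^ 2 * 4096 ^ 2 * s * Real.exp 4096) * hcancel +
      (10 ^ 13 - 9 * 16 * 144 ^ 2 * 4096 ^ 2 * (16 / 81)) * hpos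
  calc (n : ℝ) ^ 2 ≤ (16 * s * M) ^ 2 := by gcongr
    _ = 256 * (s : ℝ) ^ 2 * (M : ℝ) ^ 2 := by ring
    _ ≤ 256 * (s : ℝ) ^ 2 * (10 ^ 13 * Real.exp 4096 * (s * ε ^ 4)) := by gcongr
    _ = 256 * 10 ^ 13 * Real.exp 4096 * (s ^ 3 * ε ^ 4) := by ring
    _ ≤ _ := by gcongr; norm_num

end Closeness

section SampleComplexity

variable {n s : ℕ} [NeZero n] {ε : ℝ} {T : Algorithm n}

lemma IsClosenessTester.pos_of_drawsAtMost (hn : 2 ≤ n) (h0 : 0 ≤ ε) (h1 : ε ≤ 1)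
    (hT : IsClosenessTester (PMF.uniformOfFintype (Fin n)) ε T) (hs : T.DrawsAtMost s) :
    0 < s := by
  by_contra hs0
  have hle : (n : ℝ) ≤ 0 := by
    simpa [Nat.eq_zero_of_not_pos hs0] using hT.card_le_of_drawsAtMost hn h0 h1 hs
  have hn0 : n = 0 := Nat.cast_nonpos.1 hle
  lia

lemma IsClosenessTester.sq_card_le_of_drawsAtMost (hn : 2 ≤ n) (h0 : 0 ≤ ε) (h1 : ε ≤ 1)
    (hT : IsClosenessTester (PMF.uniformOfFintype (Fin n)) ε T) (hs : T.DrawsAtMost s) :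
    (n : ℝ) ^ 2 ≤ 10 ^ 16 * Real.exp 4096 * (s ^ 3 * ε ^ 4) := by
  rcases le_or_gt (8 * s) n with hsn | hns
  · exact hT.sq_card_le_of_drawsAtMost_of_eight_mul_le (hT.pos_of_drawsAtMost hn h0 h1 hs) hsn h0 h1
      hs
  · have hle : (n : ℝ) ≤ 8 * s := by exact_mod_cast hns.le
    have hexp : 1 ≤ Real.exp 4096 := Real.one_le_exp (by norm_num)
    calc (n : ℝ) ^ 2 = n * n := sq _
      _ ≤ 8 * s * (27 * s ^ 2 * ε ^ 4) := by
          gcongr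
          exact hT.card_le_of_drawsAtMost hn h0 h1 hs
      _ = 216 * (s ^ 3 * ε ^ 4) := by ring
      _ ≤ _ := by
          gcongr
          linarith

lemma rpow_div_rpow_le_of_sq_le {C x y : ℝ} (hC : 1 ≤ C) (hx : 0 ≤ x) (hy : 0 ≤ y) (hε : 0 < ε)
    (h : x ^ 2 ≤ C * (y ^ 3 * ε ^ 4)) : x ^ (2 / 3 : ℝ) / ε ^ (4 / 3 : ℝ) ≤ C * y := by
  have hx3 : (x ^ (2 / 3 : ℝ)) ^ 3 = x ^ 2 := by
    rw [← Real.rpow_natCast, ← Real.rpow_mul hx, ← Real.rpow_natCast]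
    norm_num
  have hε3 : (ε ^ (4 / 3 : ℝ)) ^ 3 = ε ^ 4 := by
    rw [← Real.rpow_natCast, ← Real.rpow_mul hε.le, ← Real.rpow_natCast]
    norm_num
  refine le_of_pow_le_pow_left₀ three_ne_zero (by positivity) ?_
  rw [div_pow, hx3, hε3, div_le_iff₀ (by positivity), mul_pow, mul_assoc]
  exact h.trans (mul_le_mul_of_nonneg_right (le_self_pow₀ hC three_ne_zero) (by positivity))

lemma sqrt_div_sq_le_of_le {C x y : ℝ} (hC : 0 ≤ C) (hy : 0 ≤ y) (hε : 0 < ε)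
    (h : x ≤ (C * y) ^ 2 * ε ^ 4) : Real.sqrt x / ε ^ 2 ≤ C * y := by
  rw [div_le_iff₀ (by positivity)]
  refine Real.sqrt_le_iff.2 ⟨by positivity, ?_⟩
  rwa [mul_pow, ← pow_mul]

end SampleComplexity

end MixtureTesting

theorem mainTheorem6 :
    ∃ c : ℝ, 0 < c ∧
      ∀ (n : ℕ) [NeZero n], 2 ≤ n →
      ∀ ε : ℝ, 0 < ε → ε ≤ 1 →
      ∀ T : MixtureTesting.Algorithm n,
        MixtureTesting.IsClosenessTester (PMF.uniformOfFintype (Fin n)) ε T →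
        ∀ s : ℕ, T.DrawsAtMost s →
          c * max ((n : ℝ) ^ (2 / 3 : ℝ) / ε ^ (4 / 3 : ℝ)) (Real.sqrt n / ε ^ 2) ≤ (s : ℝ) := by
  set C : ℝ := 10 ^ 16 * Real.exp 4096
  have hC : 6 ≤ C := by
    have hexp : 1 ≤ Real.exp 4096 := Real.one_le_exp (by norm_num)
    linarith
  refine ⟨C⁻¹, by positivity, fun n _ hn ε h0 h1 T hT s hs => ?_⟩
  rw [inv_mul_le_iff₀ (by positivity)]
  refine max_le ?_ ?_
  · exact MixtureTesting.rpow_div_rpow_le_of_sq_le (by linarith) n.cast_nonneg s.cast_nonneg h0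
      (hT.sq_card_le_of_drawsAtMost hn h0.le h1 hs)
  · refine MixtureTesting.sqrt_div_sq_le_of_le (by positivity) s.cast_nonneg h0 ?_
    calc (n : ℝ) ≤ 27 * s ^ 2 * ε ^ 4 := hT.card_le_of_drawsAtMost hn h0.le h1 hs
      _ ≤ 6 ^ 2 * s ^ 2 * ε ^ 4 := by gcongr; norm_num
      _ = (6 * s) ^ 2 * ε ^ 4 := by rw [mul_pow]
      _ ≤ (C * s) ^ 2 * ε ^ 4 := by gcongr
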